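/- Let $r>0$, let $V:\mathbb R\to\mathbb R$ be convex, differentiable and $L$-Lipschitz, with $V'$ also $L$-Lipschitz, and assume that $m:=e^{-V}$ satisfies $\int_{\mathbb R} m\,dx=1$. Put $\rho:=e^{-(r+1)V}$, and for a probability measure $\mu$ on $\mathbb R$ let $$\mathcal F_\rho[\mu]:=\int_{\mathbb R}\frac{\rho(x)}{f(x)^r}\,dx\quad\text{if }\mu=f\,dx,\qquad \mathcal F_\rho[\mu]:=+\infty\quad\text{if }\mu\text{ is not absolutely continuous.}$$ For $0<c<C<\infty$ let $\mathcal P_{c,C}$ be the set of probability densities $f$ on $\mathbb R$ with $c\,m\le f\le C\,m$ almost everywhere. Let $W_2(\mu,\nu)=\big(\inf_\pi\int|x-y|^2\,d\pi\big)^{1/2}$, the infimum being over all couplings $\pi$ of $\mu$ and $\nu$. A $W_2$-geodesic from $\mu_0$ to $\mu_1$ is a curve $(\mu_t)_{t\in[0,1]}$ of probability measures with finite second moment such that $W_2(\mu_s,\mu_t)=|s-t|\,W_2(\mu_0,\mu_1)$ for all $s,t\in[0,1]$. Then there is a computable constant $\lambda$, depending only on $r$, $V$, $c$ and $C$ (and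 not on $f$), such that for every $f\in\mathcal P_{c,C}$ there is exactly one $W_2$-geodesic $(\mu_t)_{t\in[0,1]}$ from $m\,dx$ to $f\,dx$, and $\mathcal F_\rho$ is $(-\lambda)$-convex along it: for all $s,t,\theta\in[0,1]$, $$\mathcal F_\rho[\mu_{(1-\theta)s+\theta t}]\le(1-\theta)\,\mathcal F_\rho[\mu_s]+\theta\,\mathcal F_\rho[\mu_t]+\frac{\lambda}{2}\,\theta(1-\theta)\,W_2(\mu_s,\mu_t)^2 .$$ Explicitly, one may take $$\lambda=(r+1)\,L\Big(\frac{(r+1)L}{r}+1\Big)\Big(Q\,\big(C/c\big)^{1+Q}\Big)^{r+1},\qquad Q:=L\,e^{\inf V}.$$ -/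

import Mathlib

open MeasureTheory Set
open scoped ENNReal NNReal

noncomputable section

/-- The measure on the real line with Lebesgue density `f`. -/
def densityMeasure (f : ℝ → ℝ) : Measure ℝ :=
  volume.withDensity fun x => ENNReal.ofReal (f x)

/-- The set of couplings of `μ` and `ν`: probability measures on the product with first marginal
`μ` and second marginal `ν`. -/
def couplings (μ ν : Measure ℝ) : Set (Measure (ℝ × ℝ)) :=
  {π | IsProbabilityMeasure π ∧ π.map Prod.fst = μ ∧ π.map Prod.snd = ν}

/-- The quadratic Wasserstein distance, with values in `[0, ∞]`. -/
def W2 (μ ν : Measure ℝ) : ℝ≥0∞ :=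
  (⨅ π ∈ couplings μ ν, ∫⁻ p, ENNReal.ofReal ((p.1 - p.2) ^ 2) ∂π) ^ (1 / 2 : ℝ)

/-- `μ` belongs to `P₂(ℝ)`: it is a probability measure with finite second moment. -/
def MemP2 (μ : Measure ℝ) : Prop :=
  IsProbabilityMeasure μ ∧ ∫⁻ x, ENNReal.ofReal (x ^ 2) ∂μ < ∞

/-- `(μ t)`, `t ∈ [0,1]`, is a `W₂`-geodesic from `μ₀` to `μ₁`
(the values of `μ` outside `[0,1]` play no role). -/
structure IsW2Geodesic (μ : ℝ → Measure ℝ) (μ₀ μ₁ : Measure ℝ) : Prop where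
  memP2 : ∀ t ∈ Icc (0 : ℝ) 1, MemP2 (μ t)
  left : μ 0 = μ₀
  right : μ 1 = μ₁
  dist_eq : ∀ s ∈ Icc (0 : ℝ) 1, ∀ t ∈ Icc (0 : ℝ) 1,
    W2 (μ s) (μ t) = ENNReal.ofReal |s - t| * W2 μ₀ μ₁

/-- The functional `F` is `K`-convex along the curve `(μ t)`, `t ∈ [0,1]` (`K` may be negative):
the convexity inequality holds between any two points of the curve. -/
def IsConvexAlong (F : Measure ℝ → ℝ≥0∞) (K : ℝ) (μ : ℝ → Measure ℝ) : Prop :=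
  ∀ s ∈ Icc (0 : ℝ) 1, ∀ t ∈ Icc (0 : ℝ) 1, ∀ θ ∈ Icc (0 : ℝ) 1,
    (F (μ ((1 - θ) * s + θ * t)) : EReal) ≤
      ((1 - θ : ℝ) : EReal) * (F (μ s) : EReal) + (θ : EReal) * (F (μ t) : EReal)
        - ((K / 2 * θ * (1 - θ) * (W2 (μ s) (μ t)).toReal ^ 2 : ℝ) : EReal)

open Classical in
/-- The functional `F_ρ[f] = ∫ ρ / f ^ r dx` on measures: `f` is the Lebesgue density of `μ`,
and the value is `∞` if `μ` has no density. -/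
def ultrafastEnergy (r : ℝ) (ρ : ℝ → ℝ) (μ : Measure ℝ) : ℝ≥0∞ :=
  if μ ≪ volume then ∫⁻ x, ENNReal.ofReal (ρ x) / (μ.rnDeriv volume x) ^ r else ∞

/-- The class `P_{c,C}` of probability densities `f` with `c m ≤ f ≤ C m` almost everywhere. -/
structure MemPcC (m : ℝ → ℝ) (c C : ℝ) (f : ℝ → ℝ) : Prop where
  aemeasurable : AEMeasurable f volume
  mass : ∫⁻ x, ENNReal.ofReal (f x) = 1
  lower : ∀ᵐ x, c * m x ≤ f x
  upper : ∀ᵐ x, f x ≤ C * m x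

/-- An explicit value of the semi-convexity constant. It depends on the exponent `r`, on the
potential `V` through its Lipschitz constant `L` and its minimal value `v`, and on `c` and `C`. -/
def semiconvexityConst (r L v c C : ℝ) : ℝ :=
  (r + 1) * L * ((r + 1) * L / r + 1) *
    (L * Real.exp v * (C / c) ^ (1 + L * Real.exp v)) ^ (r + 1)

end

/-! On the line the comonotone coupling is optimal (`W2_map_map_eq_eLpNorm`), so monotone maps on
the space of a fixed atomless `P` embed the Wasserstein space isometrically in L²(P). Strict
convexity of L² leaves one geodesic, the displacement interpolation φ_t = (1-t) id + t T, where T is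
the monotone map carrying m dx to f dx (`IsW2Geodesic.eq_map`).

Changing variables by φ_t turns the energy into ∫ (m(φ_t) φ_t')^(r+1) m^(-r) dx. For fixed x the
base is m(a + tS)(1 + tσ) with S = T x - x and σ = T' x - 1. The second derivative in t of its
(r+1)-st power contains (r+1)(q-p)² - q² - p', with q = σ/(1+tσ) and p = V'(a+tS) S. Since r > 0,
completing the square in q leaves only terms of size S², bounded through the Lipschitz constants of
V and V' (`ultrafast_scalar_inequality`, `convexOn_ultrafast_integrand`). Their coefficient carries
the factor (m(φ_t) φ_t')^(r+1).

It remains to bound m(φ_t) φ_t' by K m(x): then the error integrates to K^(r+1) ∫ (T x - x)² m dx, a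
multiple of W₂². The comparison of f with m gives m(T) T' ≤ m/c, and moving the argument of m costs
at most e^(L|T x - x|) (`exp_mul_deriv_le`). The displacement is bounded because tails of a
log-concave density decay at least at the rate max m = e^(-inf V), while x and T x have comparable
tails; hence max m · |T x - x| ≤ log(C/c) (`exp_displacement_le`). -/

/-! ### Optimal couplings on the line -/

theorem measurableSet_setOf_le_and_lt {α : Type*} [MeasurableSpace α] {f g h k : α → ℝ}
    (hf : Measurable f) (hg : Measurable g) (hh : Measurable h) (hk : Measurable k) :
    MeasurableSet {x | f x ≤ g x ∧ h x < k x} :=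
  (measurableSet_le hf hg).inter (measurableSet_lt hh hk)

/-- The squared distance is the area of the square with side the interval between the points; one of
the two indicators always vanishes. -/
theorem ofReal_sub_sq_eq_lintegral (x y : ℝ) :
    ENNReal.ofReal ((x - y) ^ 2) = ∫⁻ q : ℝ × ℝ,
      ({q : ℝ × ℝ | x ≤ min q.1 q.2 ∧ max q.1 q.2 < y}.indicator 1 q +
       {q : ℝ × ℝ | y ≤ min q.1 q.2 ∧ max q.1 q.2 < x}.indicator 1 q) := by
  have key : ∀ a b : ℝ, {q : ℝ × ℝ | a ≤ min q.1 q.2 ∧ max q.1 q.2 < b} = Ico a b ×ˢ Ico a b := by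
    intro a b
    ext q
    simp only [mem_ofPred_eq, le_min_iff, max_lt_iff, mem_prod, mem_Ico]
    tauto
  have hm : ∀ a b : ℝ, MeasurableSet (Ico a b ×ˢ Ico a b) :=
    fun a b => measurableSet_Ico.prod measurableSet_Ico
  rw [key, key, lintegral_add_left (measurable_one.indicator (hm _ _)),
    lintegral_indicator_one (hm _ _), lintegral_indicator_one (hm _ _), Measure.volume_eq_prod,
    Measure.prod_prod, Measure.prod_prod, Real.volume_Ico, Real.volume_Ico]
  rcases le_total x y with h | h
  · rw [ENNReal.ofReal_of_nonpos (sub_nonpos.2 h), mul_zero, add_zero,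
      ← ENNReal.ofReal_mul (sub_nonneg.2 h)]
    congr 1; ring
  · rw [ENNReal.ofReal_of_nonpos (sub_nonpos.2 h), mul_zero, zero_add,
      ← ENNReal.ofReal_mul (sub_nonneg.2 h)]
    congr 1; ring

/-- By Tonelli the cost becomes a superposition of quadrant masses, so optimality can be tested on
each quadrant separately. -/
theorem lintegral_ofReal_sub_sq_eq (π : Measure (ℝ × ℝ)) [SFinite π] :
    ∫⁻ p, ENNReal.ofReal ((p.1 - p.2) ^ 2) ∂π = ∫⁻ q : ℝ × ℝ,
      (π {p | p.1 ≤ min q.1 q.2 ∧ max q.1 q.2 < p.2} +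
       π {p | p.2 ≤ min q.1 q.2 ∧ max q.1 q.2 < p.1}) := by
  simp_rw [ofReal_sub_sq_eq_lintegral]
  have m1 : MeasurableSet {z : (ℝ × ℝ) × (ℝ × ℝ) |
      z.1.1 ≤ min z.2.1 z.2.2 ∧ max z.2.1 z.2.2 < z.1.2} :=
    measurableSet_setOf_le_and_lt (by fun_prop) (by fun_prop) (by fun_prop) (by fun_prop)
  have m2 : MeasurableSet {z : (ℝ × ℝ) × (ℝ × ℝ) |
      z.1.2 ≤ min z.2.1 z.2.2 ∧ max z.2.1 z.2.2 < z.1.1} :=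
    measurableSet_setOf_le_and_lt (by fun_prop) (by fun_prop) (by fun_prop) (by fun_prop)
  rw [lintegral_lintegral_swap]
  · refine lintegral_congr fun q => ?_
    have n1 : MeasurableSet {p : ℝ × ℝ | p.1 ≤ min q.1 q.2 ∧ max q.1 q.2 < p.2} :=
      m1.preimage (measurable_id.prodMk measurable_const)
    have n2 : MeasurableSet {p : ℝ × ℝ | p.2 ≤ min q.1 q.2 ∧ max q.1 q.2 < p.1} :=
      m2.preimage (measurable_id.prodMk measurable_const)
    rw [← lintegral_indicator_one n1, ← lintegral_indicator_one n2,
      ← lintegral_add_left (measurable_one.indicator n1)]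
    rfl
  · have a1 := (measurable_one (β := (ℝ × ℝ) × (ℝ × ℝ)) (α := ℝ≥0∞)).indicator m1
    have a2 := (measurable_one (β := (ℝ × ℝ) × (ℝ × ℝ)) (α := ℝ≥0∞)).indicator m2
    exact (a1.add a2).aemeasurable

/-- Among all couplings, a comonotone one gives the least mass to the quadrants above the
diagonal. -/
theorem measure_comonotone_le {P : Measure ℝ} [IsProbabilityMeasure P] {X Y : ℝ → ℝ}
    (hX : Monotone X) (hY : Monotone Y) {π : Measure (ℝ × ℝ)} [IsProbabilityMeasure π]
    (h1 : π.map Prod.fst = P.map X) (h2 : π.map Prod.snd = P.map Y) (a b : ℝ) :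
    P {x | X x ≤ a ∧ b < Y x} ≤ π {p | p.1 ≤ a ∧ b < p.2} := by
  have e1 : {x | X x ≤ a ∧ b < Y x} = (X ⁻¹' Iic a) \ (Y ⁻¹' Iic b) := by
    ext x; simp
  have e2 : {p : ℝ × ℝ | p.1 ≤ a ∧ b < p.2} = (Prod.fst ⁻¹' Iic a) \ (Prod.snd ⁻¹' Iic b) := by
    ext x; simp
  have hYm : MeasurableSet (Y ⁻¹' Iic b) := hY.measurable measurableSet_Iic
  rw [e1, e2]
  -- Lower sets of a line are nested, so the comonotone mass is the positive part of P(X ≤ a) - P(Y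
  -- ≤ b). This depends on the marginals only and bounds every coupling from below.
  have hlow : IsLowerSet (X ⁻¹' Iic a) := fun x y hxy hx => (hX hxy).trans hx
  have hlow' : IsLowerSet (Y ⁻¹' Iic b) := fun x y hxy hx => (hY hxy).trans hx
  rcases hlow.total hlow' with h | h
  · rw [sdiff_eq_empty.2 h]; simp
  · rw [measure_sdiff h hYm.nullMeasurableSet (measure_ne_top _ _),
      ← Measure.map_apply hX.measurable measurableSet_Iic,
      ← Measure.map_apply hY.measurable measurableSet_Iic, ← h1, ← h2,
      Measure.map_apply measurable_fst measurableSet_Iic,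
      Measure.map_apply measurable_snd measurableSet_Iic]
    exact le_measure_sdiff

/-- The comonotone coupling is optimal for the quadratic cost on the line. -/
theorem W2_map_map_eq_eLpNorm {P : Measure ℝ} [IsProbabilityMeasure P] {X Y : ℝ → ℝ}
    (hX : Monotone X) (hY : Monotone Y) :
    W2 (P.map X) (P.map Y) = eLpNorm (fun x => X x - Y x) 2 P := by
  have hXY : Measurable fun x => (X x, Y x) := hX.measurable.prodMk hY.measurable
  have hint : ∫⁻ x, ENNReal.ofReal ((X x - Y x) ^ 2) ∂P =
      ∫⁻ p, ENNReal.ofReal ((p.1 - p.2) ^ 2) ∂(P.map fun x => (X x, Y x)) := by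
    rw [lintegral_map (by fun_prop) hXY]
  have hcoup : (P.map fun x => (X x, Y x)) ∈ couplings (P.map X) (P.map Y) := by
    refine ⟨Measure.isProbabilityMeasure_map hXY.aemeasurable, ?_, ?_⟩
    · rw [Measure.map_map measurable_fst hXY]; rfl
    · rw [Measure.map_map measurable_snd hXY]; rfl
  have hinf : (⨅ π ∈ couplings (P.map X) (P.map Y), ∫⁻ p, ENNReal.ofReal ((p.1 - p.2) ^ 2) ∂π) =
      ∫⁻ x, ENNReal.ofReal ((X x - Y x) ^ 2) ∂P := by
    refine le_antisymm ?_ ?_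
    · rw [hint]; exact iInf₂_le _ hcoup
    · refine le_iInf₂ fun π hπ => ?_
      obtain ⟨hp, h1, h2⟩ := hπ
      have := hcoup.1
      rw [hint, lintegral_ofReal_sub_sq_eq, lintegral_ofReal_sub_sq_eq]
      refine lintegral_mono fun q => add_le_add ?_ ?_
      · rw [Measure.map_apply hXY (measurableSet_setOf_le_and_lt (by fun_prop) (by fun_prop)
          (by fun_prop) (by fun_prop))]
        exact measure_comonotone_le hX hY h1 h2 _ _
      · rw [Measure.map_apply hXY (measurableSet_setOf_le_and_lt (by fun_prop) (by fun_prop)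
          (by fun_prop) (by fun_prop))]
        have hs : IsProbabilityMeasure (π.map Prod.swap) :=
          Measure.isProbabilityMeasure_map measurable_swap.aemeasurable
        have := measure_comonotone_le (π := π.map Prod.swap) hY hX
          (by rw [Measure.map_map measurable_fst measurable_swap]; exact h2)
          (by rw [Measure.map_map measurable_snd measurable_swap]; exact h1)
          (min q.1 q.2) (max q.1 q.2)
        rwa [Measure.map_apply measurable_swap (measurableSet_setOf_le_and_lt (by fun_prop) (by fun_prop)
          (by fun_prop) (by fun_prop))] at this
  rw [W2, hinf, eLpNorm_eq_lintegral_rpow_enorm_toReal two_ne_zero ENNReal.ofNat_ne_top]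
  simp only [ENNReal.toReal_ofNat]
  congr 1
  refine lintegral_congr fun x => ?_
  rw [Real.enorm_eq_ofReal_abs, ENNReal.rpow_ofNat, ← ENNReal.ofReal_pow (abs_nonneg _), sq_abs]

/-! ### Monotone rearrangement and displacement geodesics -/

/-- Every probability measure on the line is the image of an atomless one of full support under a
monotone map. -/
theorem exists_monotone_map_eq {P : Measure ℝ} [IsProbabilityMeasure P]
    (hc : Continuous (ProbabilityTheory.cdf P)) (hs : StrictMono (ProbabilityTheory.cdf P))
    (ν : Measure ℝ) [IsProbabilityMeasure ν] :
    ∃ X : ℝ → ℝ, Monotone X ∧ P.map X = ν := by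
  open ProbabilityTheory Filter in
  have h0 : ∀ x, 0 < cdf P x := fun x => (cdf_nonneg P (x - 1)).trans_lt (hs (by linarith))
  have h1 : ∀ x, cdf P x < 1 := fun x => (hs (by linarith : x < x + 1)).trans_le (cdf_le_one P _)
  have hne : ∀ x, {y | cdf P x ≤ cdf ν y}.Nonempty := fun x =>
    (((tendsto_cdf_atTop ν).eventually (lt_mem_nhds (h1 x))).exists).imp fun y hy => le_of_lt hy
  have hbdd : ∀ x, BddBelow {y | cdf P x ≤ cdf ν y} := fun x => by
    obtain ⟨z, hz⟩ := ((tendsto_cdf_atBot ν).eventually (gt_mem_nhds (h0 x))).exists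
    refine ⟨z, fun y hy => ?_⟩
    by_contra hlt
    exact absurd (monotone_cdf ν (not_le.1 hlt).le) (not_le.2 (hz.trans_le hy))
  set X : ℝ → ℝ := fun x => sInf {y | cdf P x ≤ cdf ν y} with hXdef
  have hX : Monotone X := fun x x' hxx =>
    csInf_le_csInf (hbdd x) (hne x') fun y hy => (monotone_cdf P hxx).trans hy
  -- The Galois connection of the quantile function; right continuity of `cdf ν` shows that the
  -- infimum is attained.
  have hiff : ∀ x y, X x ≤ y ↔ cdf P x ≤ cdf ν y := by
    intro x y
    refine ⟨fun h => ?_, fun h => csInf_le (hbdd x) h⟩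
    refine ge_of_tendsto (((cdf ν).right_continuous y).mono_left
      (nhdsWithin_mono y Ioi_subset_Ici_self)) ?_
    filter_upwards [self_mem_nhdsWithin] with z hz
    obtain ⟨w, hw, hwz⟩ := exists_lt_of_csInf_lt (hne x) (lt_of_le_of_lt h hz)
    exact le_trans hw (monotone_cdf ν hwz.le)
  refine ⟨X, hX, ?_⟩
  have : IsProbabilityMeasure (P.map X) := Measure.isProbabilityMeasure_map hX.measurable.aemeasurable
  refine Measure.ext_of_Iic _ _ fun y => ?_
  rw [Measure.map_apply hX.measurable measurableSet_Iic, ← ofReal_cdf ν y]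
  have hpre : X ⁻¹' Iic y = {x | cdf P x ≤ cdf ν y} := by ext x; exact hiff x y
  rw [hpre]
  rcases (cdf_nonneg ν y).eq_or_lt with h | h
  · rw [← h, ENNReal.ofReal_zero]
    convert measure_empty (μ := P)
    ext x; simpa using h0 x
  rcases (cdf_le_one ν y).eq_or_lt with h' | h'
  · rw [h', ENNReal.ofReal_one, ← measure_univ (μ := P)]
    congr 1
    ext x; simpa using (h1 x).le
  · obtain ⟨x₀, hx₀⟩ := mem_range_of_exists_le_of_exists_ge hc
      (((tendsto_cdf_atBot P).eventually (gt_mem_nhds h)).exists.imp fun _ hx => le_of_lt hx)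
      (((tendsto_cdf_atTop P).eventually (lt_mem_nhds h')).exists.imp fun _ hx => le_of_lt hx)
    rw [← hx₀, ofReal_cdf]
    congr 1
    ext x; exact hs.le_iff_le

theorem memP2_map_iff {P : Measure ℝ} [IsProbabilityMeasure P] {X : ℝ → ℝ} (hX : Measurable X) :
    MemP2 (P.map X) ↔ MemLp X 2 P := by
  have hP : IsProbabilityMeasure (P.map X) := Measure.isProbabilityMeasure_map hX.aemeasurable
  have h : ∫⁻ x, ENNReal.ofReal (x ^ 2) ∂(P.map X) = ∫⁻ x, ‖X x‖ₑ ^ (2 : ℝ) ∂P := by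
    rw [lintegral_map (by fun_prop) hX]
    refine lintegral_congr fun x => ?_
    rw [Real.enorm_eq_ofReal_abs, ENNReal.rpow_ofNat, ← ENNReal.ofReal_pow (abs_nonneg _), sq_abs]
  have h2 : eLpNorm X 2 P < ∞ ↔ ∫⁻ x, ‖X x‖ₑ ^ (2 : ℝ) ∂P < ∞ := by
    simpa using eLpNorm_lt_top_iff_lintegral_rpow_enorm_lt_top (f := X) (μ := P) two_ne_zero
      ENNReal.ofNat_ne_top
  rw [MemP2, h, ← h2]
  exact ⟨fun H => ⟨hX.aestronglyMeasurable, H.2⟩, fun H => ⟨hP, H.2⟩⟩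

theorem monotone_interpolate {X Y : ℝ → ℝ} (hX : Monotone X) (hY : Monotone Y) {t : ℝ}
    (ht : t ∈ Icc (0 : ℝ) 1) : Monotone fun x => (1 - t) * X x + t * Y x :=
  (hX.const_mul (sub_nonneg.2 ht.2)).add (hY.const_mul ht.1)

/-- The displacement interpolation between the images of `P` under two monotone maps is a
`W₂`-geodesic. -/
theorem isW2Geodesic_map {P : Measure ℝ} [IsProbabilityMeasure P] {X Y : ℝ → ℝ}
    (hX : Monotone X) (hY : Monotone Y) (hX2 : MemLp X 2 P) (hY2 : MemLp Y 2 P) :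
    IsW2Geodesic (fun t => P.map fun x => (1 - t) * X x + t * Y x) (P.map X) (P.map Y) where
  memP2 t ht := (memP2_map_iff (monotone_interpolate hX hY ht).measurable).2
    ((hX2.const_mul _).add (hY2.const_mul _))
  left := by simp
  right := by simp
  dist_eq s hs t ht := by
    rw [W2_map_map_eq_eLpNorm (monotone_interpolate hX hY hs) (monotone_interpolate hX hY ht),
      W2_map_map_eq_eLpNorm hX hY]
    have : (fun x => (1 - s) * X x + s * Y x - ((1 - t) * X x + t * Y x)) =
        (t - s) • fun x => X x - Y x := by
      ext x; simp only [Pi.smul_apply, smul_eq_mul]; ring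
    rw [this, eLpNorm_const_smul, Real.enorm_eq_ofReal_abs, abs_sub_comm]

/-- Uniqueness of geodesics: the monotone rearrangement embeds `P₂(ℝ)` isometrically in a Hilbert
space. -/
theorem IsW2Geodesic.eq_map {P : Measure ℝ} [IsProbabilityMeasure P]
    (hc : Continuous (ProbabilityTheory.cdf P)) (hs : StrictMono (ProbabilityTheory.cdf P))
    {X Y : ℝ → ℝ} (hX : Monotone X) (hY : Monotone Y) (hX2 : MemLp X 2 P) (hY2 : MemLp Y 2 P)
    {ν : ℝ → Measure ℝ} (hν : IsW2Geodesic ν (P.map X) (P.map Y)) {t : ℝ}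
    (ht : t ∈ Icc (0 : ℝ) 1) : ν t = P.map fun x => (1 - t) * X x + t * Y x := by
  have := (hν.memP2 t ht).1
  obtain ⟨Z, hZ, hZν⟩ := exists_monotone_map_eq hc hs (ν t)
  have hZ2 : MemLp Z 2 P := (memP2_map_iff hZ.measurable).1 (hZν ▸ hν.memP2 t ht)
  have dist_eq : ∀ {A B : ℝ → ℝ} (hA : Monotone A) (hB : Monotone B) (hA2 : MemLp A 2 P)
      (hB2 : MemLp B 2 P), dist (hA2.toLp A) (hB2.toLp B) = (W2 (P.map A) (P.map B)).toReal := by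
    intro A B hA hB hA2 hB2
    rw [dist_edist, Lp.edist_toLp_toLp, W2_map_map_eq_eLpNorm hA hB]
    rfl
  have d1 : dist (hX2.toLp X) (hZ2.toLp Z) = t * dist (hX2.toLp X) (hY2.toLp Y) := by
    rw [dist_eq hX hZ, dist_eq hX hY, hZν, ← hν.left, hν.dist_eq 0 (by simp) t ht, hν.left,
      ENNReal.toReal_mul, ENNReal.toReal_ofReal (abs_nonneg _), zero_sub, abs_neg,
      abs_of_nonneg ht.1]
  have d2 : dist (hZ2.toLp Z) (hY2.toLp Y) = (1 - t) * dist (hX2.toLp X) (hY2.toLp Y) := by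
    rw [dist_eq hZ hY, dist_eq hX hY, hZν, ← hν.right, hν.dist_eq t ht 1 (by simp), hν.right,
      ENNReal.toReal_mul, ENNReal.toReal_ofReal (abs_nonneg _), abs_sub_comm,
      abs_of_nonneg (sub_nonneg.2 ht.2)]
  -- In the strictly convex space L²(P), the distances to the two endpoints determine a point of the
  -- segment.
  have key := eq_lineMap_of_dist_eq_mul_of_dist_eq_mul d1 d2
  rw [AffineMap.lineMap_apply_module] at key
  rw [← hZν]
  refine Measure.map_congr ?_
  have e1 := hZ2.coeFn_toLp
  rw [key] at e1
  filter_upwards [e1, hX2.coeFn_toLp, hY2.coeFn_toLp,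
    Lp.coeFn_add ((1 - t) • hX2.toLp X) (t • hY2.toLp Y), Lp.coeFn_smul (1 - t) (hX2.toLp X),
    Lp.coeFn_smul t (hY2.toLp Y)] with x h1 h2 h3 h4 h5 h6
  rw [← h1, h4, Pi.add_apply, h5, h6, Pi.smul_apply, Pi.smul_apply, h2, h3]
  rfl

/-! ### Semiconvexity of the integrand in time -/

theorem AbsolutelyContinuousOnInterval.le_of_ae_deriv_nonneg {f : ℝ → ℝ} {a b : ℝ} (hab : a ≤ b)
    (hf : AbsolutelyContinuousOnInterval f a b)
    (h : ∀ᵐ x, x ∈ uIcc a b → 0 ≤ deriv f x) : f a ≤ f b := by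
  rw [← sub_nonneg, ← hf.integral_deriv_eq_sub]
  refine intervalIntegral.integral_nonneg_of_ae_restrict hab ?_
  rw [Filter.EventuallyLE, ae_restrict_iff' measurableSet_Icc]
  filter_upwards [h] with x hx hx'
  exact hx (uIcc_of_le hab ▸ hx')

/-- The scalar inequality behind the semiconvexity of the ultrafast diffusion energy. -/
theorem ultrafast_scalar_inequality {r L S p p' q G B : ℝ} (hr : 0 < r) (hL : 0 ≤ L)
    (hp : |p| ≤ L * |S|) (hp' : |p'| ≤ L * S ^ 2) (hG : 0 ≤ G) (hGB : G ≤ B) :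
    0 ≤ ((r + 1) * (G * (q - p))) * (q - p) + G * (-p' - q ^ 2) +
      L * ((r + 1) * L / r + 1) * B * S ^ 2 := by
  have h1 : p ^ 2 ≤ L ^ 2 * S ^ 2 := by
    have := pow_le_pow_left₀ (abs_nonneg p) hp 2
    rwa [sq_abs, mul_pow, sq_abs] at this
  have h2 := (abs_le.1 hp').2
  have h3 : 0 ≤ r * (q - (r + 1) / r * p) ^ 2 := by positivity
  -- Completing the square in `q`, about which nothing is known; this needs r > 0 and produces the
  -- constant (r+1)/r.
  have h4 : r * (q - (r + 1) / r * p) ^ 2 =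
      (r + 1) * (q - p) ^ 2 - q ^ 2 + (r + 1) / r * p ^ 2 := by
    field_simp; ring
  have h5 : (r + 1) / r * p ^ 2 ≤ (r + 1) / r * (L ^ 2 * S ^ 2) := by gcongr
  have h6 : 0 ≤ (r + 1) * (q - p) ^ 2 - q ^ 2 - p' + L * ((r + 1) * L / r + 1) * S ^ 2 := by
    have : L * ((r + 1) * L / r + 1) * S ^ 2 = (r + 1) / r * (L ^ 2 * S ^ 2) + L * S ^ 2 := by
      ring
    rw [this]; linarith
  have h7 : 0 ≤ L * ((r + 1) * L / r + 1) * S ^ 2 := by positivity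
  nlinarith [mul_nonneg hG h6, mul_le_mul_of_nonneg_left hGB h7]

/-- Along a line, `(m (a + t S) (1 + t σ)) ^ (r + 1)` with `m = e ^ {-V}` is semiconvex. -/
theorem convexOn_ultrafast_integrand {V : ℝ → ℝ} {L : ℝ≥0} (hV_lip : LipschitzWith L V)
    (hV_diff : Differentiable ℝ V) (hV'_lip : LipschitzWith L (deriv V)) {r : ℝ} (hr : 0 < r)
    {a S σ B : ℝ} (hσ : ∀ t ∈ Icc (0 : ℝ) 1, 0 < 1 + t * σ)
    (hB : ∀ t ∈ Icc (0 : ℝ) 1, Real.exp (-V (a + t * S)) * (1 + t * σ) ≤ B) :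
    ConvexOn ℝ (Icc 0 1) fun t => (Real.exp (-V (a + t * S)) * (1 + t * σ)) ^ (r + 1) +
      (r + 1) * L * ((r + 1) * L / r + 1) * B ^ (r + 1) * S ^ 2 / 2 * t ^ 2 := by
  set G : ℝ → ℝ := fun t => (Real.exp (-V (a + t * S)) * (1 + t * σ)) ^ (r + 1) with hGdef
  set K : ℝ := L * ((r + 1) * L / r + 1) * B ^ (r + 1) * S ^ 2 with hK
  -- The logarithmic derivative of the base, so that G' = (r+1) G φ.
  set φ : ℝ → ℝ := fun t => σ / (1 + t * σ) - deriv V (a + t * S) * S with hφ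
  have hline : ∀ t, HasDerivAt (fun t => a + t * S) S t := fun t => by
    simpa using ((hasDerivAt_id t).mul_const S).const_add a
  have hlin' : ∀ t, HasDerivAt (fun t => 1 + t * σ) σ t := fun t => by
    simpa using ((hasDerivAt_id t).mul_const σ).const_add 1
  have hkpos : ∀ t ∈ Icc (0 : ℝ) 1, 0 < Real.exp (-V (a + t * S)) * (1 + t * σ) :=
    fun t ht => mul_pos (Real.exp_pos _) (hσ t ht)
  have hG : ∀ t ∈ Icc (0 : ℝ) 1, HasDerivAt G ((r + 1) * (G t * φ t)) t := by
    intro t ht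
    have h1 := ((((hV_diff _).hasDerivAt.comp t (hline t)).neg.exp).mul (hlin' t)).rpow_const
      (p := r + 1) (Or.inl (hkpos t ht).ne')
    refine h1.congr_deriv ?_
    simp only [Pi.neg_apply, Function.comp, Pi.mul_apply]
    rw [hGdef, hφ]
    simp only
    rw [Real.rpow_add (hkpos t ht), Real.rpow_one, add_sub_cancel_right]
    have := (hσ t ht).ne'
    field_simp
    ring
  have hfull : ∀ t ∈ Icc (0 : ℝ) 1, HasDerivAt (fun t => G t +
      (r + 1) * L * ((r + 1) * L / r + 1) * B ^ (r + 1) * S ^ 2 / 2 * t ^ 2)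
      ((r + 1) * (G t * φ t + K * t)) t := by
    intro t ht
    refine ((hG t ht).add ((hasDerivAt_pow 2 t).const_mul _)).congr_deriv ?_
    rw [hK]; push_cast; ring
  -- V need not be twice differentiable, but V' is Lipschitz. The first derivative is therefore
  -- absolutely continuous, and the sign of its derivative almost everywhere suffices.
  have hmono : MonotoneOn (fun t => G t * φ t + K * t) (Icc 0 1) := by
    intro s hs t ht hst
    have hsub : uIcc s t ⊆ Icc 0 1 := by
      rw [uIcc_of_le hst]; exact Icc_subset_Icc hs.1 ht.2
    have hV1 : ContDiff ℝ 1 V := contDiff_one_iff_deriv.2 ⟨hV_diff, hV'_lip.continuous⟩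
    have hGac : AbsolutelyContinuousOnInterval G s t := by
      refine ContDiffOn.absolutelyContinuousOnInterval ?_
      refine ContDiffOn.rpow_const_of_ne ?_ fun x hx => (hkpos x (hsub hx)).ne'
      exact ContDiff.contDiffOn (by fun_prop)
    have hqac : AbsolutelyContinuousOnInterval (fun t => σ / (1 + t * σ)) s t := by
      refine ContDiffOn.absolutelyContinuousOnInterval ?_
      exact contDiffOn_const.div (ContDiff.contDiffOn (by fun_prop))
        fun x hx => (hσ x (hsub hx)).ne'
    have hplip : LipschitzWith (Real.toNNReal (L * S ^ 2)) fun t => deriv V (a + t * S) * S := by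
      refine LipschitzWith.of_dist_le_mul fun x y => ?_
      have := hV'_lip.dist_le_mul (a + x * S) (a + y * S)
      rw [Real.coe_toNNReal _ (by positivity)]
      rw [Real.dist_eq] at this ⊢
      rw [Real.dist_eq] at this ⊢
      rw [← sub_mul, abs_mul]
      have e : a + x * S - (a + y * S) = (x - y) * S := by ring
      rw [e, abs_mul] at this
      calc _ ≤ (L * (|x - y| * |S|)) * |S| := by gcongr
        _ = L * S ^ 2 * |x - y| := by rw [← sq_abs S]; ring
    have hpac : AbsolutelyContinuousOnInterval (fun t => deriv V (a + t * S) * S) s t :=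
      hplip.lipschitzOnWith.absolutelyContinuousOnInterval
    have hKac : AbsolutelyContinuousOnInterval (fun t => K * t) s t :=
      ContDiffOn.absolutelyContinuousOnInterval (ContDiff.contDiffOn (by fun_prop))
    refine AbsolutelyContinuousOnInterval.le_of_ae_deriv_nonneg hst
      ((hGac.mul (hqac.sub hpac)).add hKac) ?_
    filter_upwards [hpac.ae_differentiableAt] with x hx hxm
    have hxI := hsub hxm
    have hqd : HasDerivAt (fun t => σ / (1 + t * σ)) (-(σ / (1 + x * σ)) ^ 2) x := by
      refine ((hasDerivAt_const x σ).div (hlin' x) (hσ x hxI).ne').congr_deriv ?_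
      have := (hσ x hxI).ne'
      field_simp
      ring
    have hd := ((hG x hxI).mul (hqd.sub (hx hxm).hasDerivAt)).add
      ((hasDerivAt_id x).const_mul K)
    have hd' : deriv (fun t => G t * φ t + K * t) x = _ := hd.deriv
    change 0 ≤ deriv (fun t => G t * φ t + K * t) x
    rw [hd']
    have hp : |deriv V (a + x * S) * S| ≤ L * |S| := by
      rw [abs_mul]
      gcongr
      simpa using norm_deriv_le_of_lipschitz hV_lip (x₀ := a + x * S)
    have hp' : |deriv (fun t => deriv V (a + t * S) * S) x| ≤ L * S ^ 2 := by
      have := norm_deriv_le_of_lipschitz hplip (x₀ := x)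
      rwa [Real.coe_toNNReal _ (by positivity)] at this
    have hGB : G x ≤ B ^ (r + 1) :=
      Real.rpow_le_rpow (hkpos x hxI).le (hB x hxI) (by positivity)
    have := ultrafast_scalar_inequality (q := σ / (1 + x * σ)) hr L.coe_nonneg hp hp'
      (Real.rpow_nonneg (hkpos x hxI).le _) hGB
    refine this.trans_eq ?_
    rw [hK]
    simp only [Pi.sub_apply, hφ, hGdef]
    ring
  refine MonotoneOn.convexOn_of_deriv (convex_Icc 0 1)
    (fun t ht => (hfull t ht).continuousAt.continuousWithinAt)
    (fun t ht => (hfull t (interior_subset ht)).differentiableAt.differentiableWithinAt) ?_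
  intro s hs t ht hst
  rw [(hfull s (interior_subset hs)).deriv, (hfull t (interior_subset ht)).deriv]
  exact mul_le_mul_of_nonneg_left (hmono (interior_subset hs) (interior_subset ht) hst)
    (by positivity)

/-! ### Log-concave probability densities and their tails -/

/-- `V` is a differentiable convex potential and `e ^ {-V}` is a probability density. -/
structure IsLogConcavePotential (V : ℝ → ℝ) : Prop where
  convex : ConvexOn ℝ univ V
  diff : Differentiable ℝ V
  mass : ∫⁻ x, ENNReal.ofReal (Real.exp (-V x)) = 1

/-- The probability measure with density `e ^ {-V}`. -/
noncomputable abbrev gibbs (V : ℝ → ℝ) : Measure ℝ := densityMeasure fun x => Real.exp (-V x)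

namespace IsLogConcavePotential

variable {V : ℝ → ℝ}

theorem isProbabilityMeasure (hV : IsLogConcavePotential V) : IsProbabilityMeasure (gibbs V) :=
  ⟨by rw [gibbs, densityMeasure, withDensity_apply _ MeasurableSet.univ, setLIntegral_univ, hV.mass]⟩

theorem continuous_exp_neg (hV : IsLogConcavePotential V) :
    Continuous fun x => Real.exp (-V x) := by
  have := hV.diff.continuous
  fun_prop

theorem integrable (hV : IsLogConcavePotential V) : Integrable fun x => Real.exp (-V x) := by
  refine ⟨hV.continuous_exp_neg.aestronglyMeasurable, ?_⟩
  rw [hasFiniteIntegral_iff_ofReal (Filter.Eventually.of_forall fun x => (Real.exp_pos _).le),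
    hV.mass]
  exact ENNReal.one_lt_top

theorem tangent_le (hV : IsLogConcavePotential V) (a x : ℝ) :
    V a + deriv V a * (x - a) ≤ V x := by
  rcases lt_trichotomy a x with h | h | h
  · have := hV.convex.deriv_le_slope (mem_univ a) (mem_univ x) h (hV.diff a)
    rw [slope_def_field, le_div_iff₀ (sub_pos.2 h)] at this
    linarith
  · simp [h]
  · have := hV.convex.slope_le_deriv (mem_univ x) (mem_univ a) h (hV.diff a)
    rw [slope_def_field, div_le_iff₀ (sub_pos.2 h)] at this
    nlinarith

/-- Otherwise V is nonincreasing and the density stays above a positive constant on a half-line,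
giving infinite mass. -/
theorem exists_deriv_pos (hV : IsLogConcavePotential V) : ∃ a, 0 < deriv V a := by
  by_contra! h
  have hanti : Antitone V := antitone_of_deriv_nonpos hV.diff h
  have hle : ∫⁻ _ in Ici (0 : ℝ), ENNReal.ofReal (Real.exp (-V 0)) ≤ 1 := by
    rw [← hV.mass]
    refine (setLIntegral_mono' measurableSet_Ici fun x hx => ?_).trans (setLIntegral_le_lintegral _ _)
    exact ENNReal.ofReal_le_ofReal (Real.exp_le_exp.2 (neg_le_neg (hanti hx)))
  rw [setLIntegral_const, Real.volume_Ici, ENNReal.mul_top (by simpa using Real.exp_pos _)] at hle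
  exact absurd hle (by simp)

theorem exists_deriv_neg (hV : IsLogConcavePotential V) : ∃ a, deriv V a < 0 := by
  by_contra! h
  have hmono : Monotone V := monotone_of_deriv_nonneg hV.diff h
  have hle : ∫⁻ _ in Iic (0 : ℝ), ENNReal.ofReal (Real.exp (-V 0)) ≤ 1 := by
    rw [← hV.mass]
    refine (setLIntegral_mono' measurableSet_Iic fun x hx => ?_).trans (setLIntegral_le_lintegral _ _)
    exact ENNReal.ofReal_le_ofReal (Real.exp_le_exp.2 (neg_le_neg (hmono hx)))
  rw [setLIntegral_const, Real.volume_Iic, ENNReal.mul_top (by simpa using Real.exp_pos _)] at hle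
  exact absurd hle (by simp)

/-- Two tangent lines with slopes of opposite signs lie below V. -/
theorem exists_linear_lower_bound (hV : IsLogConcavePotential V) :
    ∃ α β : ℝ, 0 < β ∧ ∀ x, α + β * |x| ≤ V x := by
  obtain ⟨a, ha⟩ := hV.exists_deriv_pos
  obtain ⟨b, hb⟩ := hV.exists_deriv_neg
  refine ⟨min (V a - deriv V a * a) (V b - deriv V b * b), min (deriv V a) (-deriv V b),
    lt_min ha (neg_pos.2 hb), fun x => ?_⟩
  rcases le_total 0 x with hx | hx
  · have h1 := hV.tangent_le a x
    have h2 := mul_le_mul_of_nonneg_right (min_le_left (deriv V a) (-deriv V b)) hx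
    have h3 := min_le_left (V a - deriv V a * a) (V b - deriv V b * b)
    rw [abs_of_nonneg hx]
    linarith
  · have h1 := hV.tangent_le b x
    have h2 := mul_le_mul_of_nonneg_right (min_le_right (deriv V a) (-deriv V b)) (neg_nonneg.2 hx)
    have h3 := min_le_right (V a - deriv V a * a) (V b - deriv V b * b)
    rw [abs_of_nonpos hx]
    linarith

theorem tendsto_cocompact (hV : IsLogConcavePotential V) :
    Filter.Tendsto V (Filter.cocompact ℝ) Filter.atTop := by
  obtain ⟨α, β, hβ, h⟩ := hV.exists_linear_lower_bound
  refine Filter.tendsto_atTop_mono h (Filter.tendsto_atTop_add_const_left _ _ ?_)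
  exact (tendsto_norm_cocompact_atTop (E := ℝ)).const_mul_atTop hβ

theorem exists_forall_le (hV : IsLogConcavePotential V) : ∃ x₀, ∀ x, V x₀ ≤ V x :=
  hV.diff.continuous.exists_forall_le hV.tendsto_cocompact

theorem memLp_id (hV : IsLogConcavePotential V) : MemLp (fun x : ℝ => x) 2 (gibbs V) := by
  refine ⟨measurable_id.aestronglyMeasurable, ?_⟩
  rw [eLpNorm_lt_top_iff_lintegral_rpow_enorm_lt_top two_ne_zero ENNReal.ofNat_ne_top, gibbs,
    densityMeasure, lintegral_withDensity_eq_lintegral_mul _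
      (hV.continuous_exp_neg.measurable.ennreal_ofReal) (by fun_prop)]
  obtain ⟨α, β, hβ, h⟩ := hV.exists_linear_lower_bound
  -- The exponent is written as 3 - 1 to match the Gamma integral; its nonzero value already forces
  -- integrability.
  have hint : Integrable fun x : ℝ => |x| ^ (3 - 1 : ℝ) * Real.exp (-(β * |x|)) := by
    refine Integrable.of_integral_ne_zero ?_
    rw [integral_comp_abs (f := fun x : ℝ => x ^ (3 - 1 : ℝ) * Real.exp (-(β * x))),
      Real.integral_rpow_mul_exp_neg_mul_Ioi (by norm_num) hβ]
    have := Real.Gamma_pos_of_pos (s := 3) (by norm_num)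
    positivity
  refine lt_of_le_of_lt (lintegral_mono fun x => ?_) ((hint.const_mul (Real.exp (-α))).lintegral_lt_top)
  simp only [Pi.mul_apply, ENNReal.toReal_ofNat]
  rw [Real.enorm_eq_ofReal_abs, ENNReal.ofReal_rpow_of_nonneg (abs_nonneg x) (by norm_num),
    ← ENNReal.ofReal_mul (Real.exp_pos _).le]
  refine ENNReal.ofReal_le_ofReal ?_
  have : Real.exp (-V x) ≤ Real.exp (-α) * Real.exp (-(β * |x|)) := by
    rw [← Real.exp_add]
    exact Real.exp_le_exp.2 (by linarith [h x])
  rw [show (3 - 1 : ℝ) = 2 by norm_num]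
  calc _ ≤ (Real.exp (-α) * Real.exp (-(β * |x|))) * |x| ^ (2 : ℝ) := by gcongr
    _ = _ := by ring

open ProbabilityTheory in
theorem hasDerivAt_cdf (hV : IsLogConcavePotential V) (x : ℝ) :
    HasDerivAt (cdf (gibbs V)) (Real.exp (-V x)) x := by
  have hP := hV.isProbabilityMeasure
  have hcdf : ∀ y, cdf (gibbs V) y = ∫ z in Iic y, Real.exp (-V z) := by
    intro y
    rw [cdf_eq_real, measureReal_def, gibbs, densityMeasure, withDensity_apply _ measurableSet_Iic,
      integral_eq_lintegral_of_nonneg_ae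
        (Filter.Eventually.of_forall fun x => (Real.exp_pos _).le)
        hV.continuous_exp_neg.aestronglyMeasurable]
  have : (cdf (gibbs V) : ℝ → ℝ) =
      fun y => cdf (gibbs V) 0 + ∫ z in (0 : ℝ)..y, Real.exp (-V z) := by
    ext y
    rw [hcdf, hcdf, ← intervalIntegral.integral_Iic_sub_Iic hV.integrable.integrableOn
      hV.integrable.integrableOn]
    ring
  rw [this]
  exact (intervalIntegral.integral_hasDerivAt_right (hV.continuous_exp_neg.intervalIntegrable _ _)
    (hV.continuous_exp_neg.stronglyMeasurableAtFilter _ _) hV.continuous_exp_neg.continuousAt).const_add _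

open ProbabilityTheory

theorem continuous_cdf (hV : IsLogConcavePotential V) : Continuous (cdf (gibbs V)) :=
  continuous_iff_continuousAt.2 fun x => (hV.hasDerivAt_cdf x).continuousAt

theorem strictMono_cdf (hV : IsLogConcavePotential V) : StrictMono (cdf (gibbs V)) :=
  strictMono_of_deriv_pos fun x => by rw [(hV.hasDerivAt_cdf x).deriv]; exact Real.exp_pos _

theorem cdf_pos (hV : IsLogConcavePotential V) (x : ℝ) : 0 < cdf (gibbs V) x :=
  (cdf_nonneg _ (x - 1)).trans_lt (hV.strictMono_cdf (by linarith))

theorem cdf_lt_one (hV : IsLogConcavePotential V) (x : ℝ) : cdf (gibbs V) x < 1 :=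
  (hV.strictMono_cdf (by linarith : x < x + 1)).trans_le (cdf_le_one _ _)

/-- Increments of a convex function grow away from the base point. -/
theorem _root_.ConvexOn.increment_le {V : ℝ → ℝ} (hV : ConvexOn ℝ univ V) {x₀ z d : ℝ}
    (h : 0 ≤ (z - x₀) * d) : V (x₀ + d) - V x₀ ≤ V (z + d) - V z := by
  rcases eq_or_ne (z - x₀ + d) 0 with h0 | h0
  · have hd : d = 0 := by nlinarith [sq_nonneg d]
    simp [hd]
  -- Both x₀ + d and z are convex combinations of x₀ and z + d, with exchanged weights. Adding the
  -- two convexity inequalities gives the claim.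
  · set D := z - x₀ + d with hD
    have hl : 0 ≤ d / D := by
      have : d / D = d * D / (D * D) := by field_simp
      rw [this]
      exact div_nonneg (by nlinarith [sq_nonneg d]) (mul_self_nonneg _)
    have hl' : 0 ≤ (z - x₀) / D := by
      have : (z - x₀) / D = (z - x₀) * D / (D * D) := by field_simp
      rw [this]
      exact div_nonneg (by nlinarith [sq_nonneg (z - x₀)]) (mul_self_nonneg _)
    have hs : (z - x₀) / D + d / D = 1 := by rw [← add_div]; exact div_self h0
    have h1 := hV.2 (mem_univ x₀) (mem_univ (z + d)) hl' hl hs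
    have h2 := hV.2 (mem_univ x₀) (mem_univ (z + d)) hl hl' ((add_comm _ _).trans hs)
    have e1 : ((z - x₀) / D) • x₀ + (d / D) • (z + d) = x₀ + d := by
      simp only [smul_eq_mul]; field_simp; rw [hD]; ring
    have e2 : (d / D) • x₀ + ((z - x₀) / D) • (z + d) = z := by
      simp only [smul_eq_mul]; field_simp; rw [hD]; ring
    rw [e1] at h1
    rw [e2] at h2
    simp only [smul_eq_mul] at h1 h2
    have : (z - x₀) / D * V x₀ + d / D * V (z + d) + (d / D * V x₀ + (z - x₀) / D * V (z + d)) =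
      ((z - x₀) / D + d / D) * (V x₀ + V (z + d)) := by ring
    rw [hs] at this
    linarith

/-- A tail of a log-concave measure, translated away from the mode, loses mass by at least the
ratio of the densities. -/
theorem gibbs_translate_le (hV : IsLogConcavePotential V) {x₀ d : ℝ} {A B : Set ℝ}
    (hB : MeasurableSet B) (hAB : ∀ z, z ∈ A ↔ z + d ∈ B)
    (h : ∀ z ∈ A, 0 ≤ (z - x₀) * d) :
    gibbs V B ≤ ENNReal.ofReal (Real.exp (V x₀ - V (x₀ + d))) := by
  have hP := hV.isProbabilityMeasure
  rw [gibbs, densityMeasure, withDensity_apply _ hB, ← lintegral_indicator hB,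
    ← lintegral_add_right_eq_self _ d]
  calc ∫⁻ z, B.indicator (fun x => ENNReal.ofReal (Real.exp (-V x))) (z + d)
      ≤ ∫⁻ z, ENNReal.ofReal (Real.exp (V x₀ - V (x₀ + d))) * ENNReal.ofReal (Real.exp (-V z)) := by
        refine lintegral_mono fun z => ?_
        by_cases hz : z + d ∈ B
        · rw [indicator_of_mem hz, ← ENNReal.ofReal_mul (Real.exp_pos _).le, ← Real.exp_add]
          refine ENNReal.ofReal_le_ofReal (Real.exp_le_exp.2 ?_)
          linarith [hV.convex.increment_le (h z ((hAB z).2 hz))]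
        · rw [indicator_of_notMem hz]; exact zero_le
    _ = _ := by
        rw [lintegral_const_mul _ hV.continuous_exp_neg.measurable.ennreal_ofReal, hV.mass, mul_one]

/-- Translation by y - x₀ carries the half-line beyond x₀ onto the one beyond y. The resulting lower
bound on the hazard rate is sharpest when x₀ is the mode. -/
theorem one_sub_cdf_le (hV : IsLogConcavePotential V) {x₀ y : ℝ} (hy : x₀ ≤ y) :
    Real.exp (-V x₀) * (1 - cdf (gibbs V) y) ≤ Real.exp (-V y) := by
  have hP := hV.isProbabilityMeasure
  have h := hV.gibbs_translate_le (x₀ := x₀) (d := y - x₀) (A := Ioi x₀) (B := Ioi y)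
    measurableSet_Ioi (fun z => by
      simp only [mem_Ioi]; constructor <;> intro h <;> linarith)
    (fun z hz => mul_nonneg (sub_nonneg.2 (le_of_lt hz)) (sub_nonneg.2 hy))
  have h1 : 1 - cdf (gibbs V) y = (gibbs V).real (Ioi y) := by
    rw [cdf_eq_real, ← compl_Iic, probReal_compl_eq_one_sub measurableSet_Iic]
  rw [h1]
  have h2 := ENNReal.toReal_le_of_le_ofReal (Real.exp_pos _).le h
  rw [add_sub_cancel] at h2
  calc _ ≤ Real.exp (-V x₀) * Real.exp (V x₀ - V y) := by gcongr; exact h2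
    _ = _ := by rw [← Real.exp_add]; congr 1; ring

theorem cdf_le (hV : IsLogConcavePotential V) {x₀ y : ℝ} (hy : y ≤ x₀) :
    Real.exp (-V x₀) * cdf (gibbs V) y ≤ Real.exp (-V y) := by
  have hP := hV.isProbabilityMeasure
  have h := hV.gibbs_translate_le (x₀ := x₀) (d := y - x₀) (A := Iic x₀) (B := Iic y)
    measurableSet_Iic (fun z => by
      simp only [mem_Iic]; constructor <;> intro h <;> linarith)
    (fun z hz => mul_nonneg_of_nonpos_of_nonpos (sub_nonpos.2 hz) (sub_nonpos.2 hy))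
  rw [cdf_eq_real]
  have h2 := ENNReal.toReal_le_of_le_ofReal (Real.exp_pos _).le h
  rw [add_sub_cancel] at h2
  calc _ ≤ Real.exp (-V x₀) * Real.exp (V x₀ - V y) := by gcongr; exact h2
    _ = _ := by rw [← Real.exp_add]; congr 1; ring

/-- A Grönwall argument: the hazard rate is at least m(x₀) to the right of x₀, so the tail
multiplied by the matching exponential is nonincreasing. -/
theorem one_sub_cdf_decay (hV : IsLogConcavePotential V) {x₀ x y : ℝ} (hx : x₀ ≤ x) (hxy : x ≤ y) :
    Real.exp (Real.exp (-V x₀) * (y - x)) * (1 - cdf (gibbs V) y) ≤ 1 - cdf (gibbs V) x := by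
  set a := Real.exp (-V x₀)
  have hd : ∀ z, HasDerivAt (fun z => Real.exp (a * (z - x)) * (1 - cdf (gibbs V) z))
      (Real.exp (a * (z - x)) * (a * (1 - cdf (gibbs V) z) - Real.exp (-V z))) z := by
    intro z
    refine (((((hasDerivAt_id z).sub_const x).const_mul a).exp).mul
      ((hV.hasDerivAt_cdf z).const_sub 1)).congr_deriv ?_
    simp only [id, mul_one]
    ring
  have hanti : AntitoneOn (fun z => Real.exp (a * (z - x)) * (1 - cdf (gibbs V) z)) (Ici x₀) := by
    refine antitoneOn_of_deriv_nonpos (convex_Ici x₀)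
      (fun z _ => (hd z).continuousAt.continuousWithinAt)
      (fun z _ => (hd z).differentiableAt.differentiableWithinAt) fun z hz => ?_
    rw [(hd z).deriv]
    exact mul_nonpos_of_nonneg_of_nonpos (Real.exp_pos _).le
      (sub_nonpos.2 (hV.one_sub_cdf_le (interior_subset hz)))
  simpa using hanti hx (hx.trans hxy) hxy

theorem cdf_decay (hV : IsLogConcavePotential V) {x₀ x y : ℝ} (hy : y ≤ x₀) (hxy : x ≤ y) :
    Real.exp (Real.exp (-V x₀) * (y - x)) * cdf (gibbs V) x ≤ cdf (gibbs V) y := by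
  set a := Real.exp (-V x₀)
  have hd : ∀ z, HasDerivAt (fun z => Real.exp (a * (y - z)) * cdf (gibbs V) z)
      (Real.exp (a * (y - z)) * (Real.exp (-V z) - a * cdf (gibbs V) z)) z := by
    intro z
    refine (((((hasDerivAt_id z).const_sub y).const_mul a).exp).mul
      (hV.hasDerivAt_cdf z)).congr_deriv ?_
    simp only [id]
    ring
  have hmono : MonotoneOn (fun z => Real.exp (a * (y - z)) * cdf (gibbs V) z) (Iic x₀) := by
    refine monotoneOn_of_deriv_nonneg (convex_Iic x₀)
      (fun z _ => (hd z).continuousAt.continuousWithinAt)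
      (fun z _ => (hd z).differentiableAt.differentiableWithinAt) fun z hz => ?_
    rw [(hd z).deriv]
    exact mul_nonneg (Real.exp_pos _).le
      (sub_nonneg.2 (hV.cdf_le (x₀ := x₀) (y := z) (by
        rw [interior_Iic] at hz; exact le_of_lt hz)))
  simpa using hmono (hxy.trans hy) hy hxy

/-- Two points whose left tails and right tails have comparable masses are close. -/
theorem exp_mul_sub_le (hV : IsLogConcavePotential V) {x₀ x y A B : ℝ} (hxy : x ≤ y)
    (hA1 : 1 ≤ A) (hB1 : 1 ≤ B) (hA : cdf (gibbs V) y ≤ A * cdf (gibbs V) x)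
    (hB : 1 - cdf (gibbs V) x ≤ B * (1 - cdf (gibbs V) y)) :
    Real.exp (Real.exp (-V x₀) * (y - x)) ≤ A * B := by
  have hr : ∀ z, x ≤ z → x₀ ≤ z → z ≤ y → Real.exp (Real.exp (-V x₀) * (y - z)) ≤ B := by
    intro z hxz hz hzy
    have h1 := hV.one_sub_cdf_decay hz hzy
    have h2 : cdf (gibbs V) x ≤ cdf (gibbs V) z := monotone_cdf _ hxz
    exact le_of_mul_le_mul_right (by linarith) (sub_pos.2 (hV.cdf_lt_one y))
  have hl : ∀ z, z ≤ y → z ≤ x₀ → x ≤ z → Real.exp (Real.exp (-V x₀) * (z - x)) ≤ A := by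
    intro z hzy hz hxz
    have h1 := hV.cdf_decay hz hxz
    have h2 : cdf (gibbs V) z ≤ cdf (gibbs V) y := monotone_cdf _ hzy
    exact le_of_mul_le_mul_right (by linarith) (hV.cdf_pos x)
  rcases le_total x₀ x with h | h
  · exact (hr x le_rfl h hxy).trans (le_mul_of_one_le_left (by linarith) hA1)
  rcases le_total y x₀ with h' | h'
  · exact (hl y le_rfl h' hxy).trans (le_mul_of_one_le_right (by linarith) hB1)
  -- When x₀ separates the points, the left tail controls the piece before x₀ and the right tail the
  -- piece after it; hence the product of the two ratios.
  · have e : Real.exp (-V x₀) * (y - x) =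
        Real.exp (-V x₀) * (x₀ - x) + Real.exp (-V x₀) * (y - x₀) := by ring
    rw [e, Real.exp_add]
    exact mul_le_mul (hl x₀ h' le_rfl h) (hr x₀ h le_rfl h') (Real.exp_pos _).le (by linarith)

/-- Since m' = -V' m ≤ L m and m vanishes at -∞, integration gives m ≤ L times the distribution
function. The bound yields Q ≥ 1. -/
theorem exp_neg_le_of_lipschitz (hV : IsLogConcavePotential V) {L : ℝ≥0} (hL : LipschitzWith L V)
    (x : ℝ) : Real.exp (-V x) ≤ L := by
  have hd : ∀ z, HasDerivAt (fun z => L * cdf (gibbs V) z - Real.exp (-V z))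
      (Real.exp (-V z) * (L + deriv V z)) z := by
    intro z
    refine (((hV.hasDerivAt_cdf z).const_mul (L : ℝ)).sub
      ((hV.diff z).hasDerivAt.neg.exp)).congr_deriv ?_
    simp only [Pi.neg_apply]
    ring
  have hmono : Monotone fun z => L * cdf (gibbs V) z - Real.exp (-V z) := by
    refine monotone_of_deriv_nonneg (fun z => (hd z).differentiableAt) fun z => ?_
    rw [(hd z).deriv]
    have h := norm_deriv_le_of_lipschitz hL (x₀ := z)
    exact mul_nonneg (Real.exp_pos _).le (by linarith [(abs_le.1 h).1])
  have hlim : Filter.Tendsto (fun z => L * cdf (gibbs V) z - Real.exp (-V z)) Filter.atBot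
      (nhds 0) := by
    have h1 := (tendsto_cdf_atBot (gibbs V)).const_mul (L : ℝ)
    have h2 : Filter.Tendsto (fun z => Real.exp (-V z)) Filter.atBot (nhds 0) :=
      Real.tendsto_exp_neg_atTop_nhds_zero.comp (hV.tendsto_cocompact.mono_left atBot_le_cocompact)
    simpa using h1.sub h2
  have := hmono.le_of_tendsto hlim x
  nlinarith [cdf_le_one (gibbs V) x, L.coe_nonneg]

end IsLogConcavePotential

/-! ### Monotone transport between comparable densities -/

section

open ProbabilityTheory

/-- A monotone map `T` transporting `e ^ {-V} dx` to a measure whose density lies between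
`c e ^ {-V}` and `C e ^ {-V}`, described by its effect on the distribution function. -/
structure IsComparableTransport (V : ℝ → ℝ) (c C : ℝ) (T : ℝ → ℝ) : Prop where
  mono : Monotone T
  pos : 0 < c
  le_one : c ≤ 1
  one_le : 1 ≤ C
  lower : ∀ ⦃x y⦄, x ≤ y → c * (cdf (gibbs V) (T y) - cdf (gibbs V) (T x)) ≤
    cdf (gibbs V) y - cdf (gibbs V) x
  upper : ∀ ⦃x y⦄, x ≤ y → cdf (gibbs V) y - cdf (gibbs V) x ≤
    C * (cdf (gibbs V) (T y) - cdf (gibbs V) (T x))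
  left_lower : ∀ x, c * cdf (gibbs V) (T x) ≤ cdf (gibbs V) x
  left_upper : ∀ x, cdf (gibbs V) x ≤ C * cdf (gibbs V) (T x)
  right_lower : ∀ x, c * (1 - cdf (gibbs V) (T x)) ≤ 1 - cdf (gibbs V) x
  right_upper : ∀ x, 1 - cdf (gibbs V) x ≤ C * (1 - cdf (gibbs V) (T x))

theorem MemPcC.isProbabilityMeasure {m : ℝ → ℝ} {c C : ℝ} {f : ℝ → ℝ} (hf : MemPcC m c C f) :
    IsProbabilityMeasure (densityMeasure f) :=
  ⟨by rw [densityMeasure, withDensity_apply _ MeasurableSet.univ, setLIntegral_univ, hf.mass]⟩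

theorem MemPcC.smul_le {m : ℝ → ℝ} {c C : ℝ} {f : ℝ → ℝ} (hf : MemPcC m c C f) (hc : 0 ≤ c)
    (A : Set ℝ) : ENNReal.ofReal c * densityMeasure m A ≤ densityMeasure f A := by
  have h : ENNReal.ofReal c • densityMeasure m ≤ densityMeasure f := by
    rw [densityMeasure, densityMeasure, ← withDensity_smul' _ _ ENNReal.ofReal_ne_top]
    refine withDensity_mono ?_
    filter_upwards [hf.lower] with x hx
    rw [Pi.smul_apply, smul_eq_mul, ← ENNReal.ofReal_mul hc]
    exact ENNReal.ofReal_le_ofReal hx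
  exact h A

theorem MemPcC.le_smul {m : ℝ → ℝ} {c C : ℝ} {f : ℝ → ℝ} (hf : MemPcC m c C f) (hC : 0 ≤ C)
    (A : Set ℝ) : densityMeasure f A ≤ ENNReal.ofReal C * densityMeasure m A := by
  have h : densityMeasure f ≤ ENNReal.ofReal C • densityMeasure m := by
    rw [densityMeasure, densityMeasure, ← withDensity_smul' _ _ ENNReal.ofReal_ne_top]
    refine withDensity_mono ?_
    filter_upwards [hf.upper] with x hx
    rw [Pi.smul_apply, smul_eq_mul, ← ENNReal.ofReal_mul hC]
    exact ENNReal.ofReal_le_ofReal hx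
  exact h A

/-- A monotone map pushing a measure to an atomless one preserves distribution functions. -/
theorem cdf_map_apply_of_monotone {P : Measure ℝ} [IsProbabilityMeasure P] {T : ℝ → ℝ}
    (hT : Monotone T) [NullSingletonClass (P.map T)] (x : ℝ) : cdf (P.map T) (T x) = cdf P x := by
  have := Measure.isProbabilityMeasure_map (μ := P) hT.measurable.aemeasurable
  refine le_antisymm ?_ ?_
  -- T may be flat, so T z ≤ T x does not give z ≤ x, whereas T z < T x does. The absence of atoms
  -- allows the open half-line.
  · rw [cdf_eq_real, cdf_eq_real, measureReal_congr Iio_ae_eq_Iic.symm,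
      map_measureReal_apply hT.measurable measurableSet_Iio]
    refine measureReal_mono fun z hz => ?_
    by_contra h
    exact absurd (hT (not_le.1 h).le) (not_le.2 hz)
  · rw [cdf_eq_real, cdf_eq_real, map_measureReal_apply hT.measurable measurableSet_Iic]
    exact measureReal_mono fun z hz => hT hz

theorem IsLogConcavePotential.isComparableTransport {V : ℝ → ℝ} (hV : IsLogConcavePotential V)
    {c C : ℝ} (hc : 0 < c) (hcC : c < C) {f T : ℝ → ℝ}
    (hf : MemPcC (fun x => Real.exp (-V x)) c C f) (hT : Monotone T)
    (hTf : (gibbs V).map T = densityMeasure f) : IsComparableTransport V c C T := by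
  have hP := hV.isProbabilityMeasure
  have hF := hf.isProbabilityMeasure
  have hC : 0 < C := hc.trans hcC
  have lo : ∀ A, c * (gibbs V).real A ≤ (densityMeasure f).real A := fun A => by
    have := ENNReal.toReal_mono (measure_ne_top _ _) (hf.smul_le hc.le A)
    rwa [ENNReal.toReal_mul, ENNReal.toReal_ofReal hc.le] at this
  have up : ∀ A, (densityMeasure f).real A ≤ C * (gibbs V).real A := fun A => by
    have := ENNReal.toReal_mono (ENNReal.mul_ne_top ENNReal.ofReal_ne_top (measure_ne_top _ _))
      (hf.le_smul hC.le A)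
    rwa [ENNReal.toReal_mul, ENNReal.toReal_ofReal hC.le] at this
  have hna : NullSingletonClass ((gibbs V).map T) := by
    rw [hTf, densityMeasure]; infer_instance
  have hcdf : ∀ x, cdf (densityMeasure f) (T x) = cdf (gibbs V) x := fun x => by
    rw [← hTf]; exact cdf_map_apply_of_monotone hT x
  have hIic : ∀ (μ : Measure ℝ) [IsProbabilityMeasure μ] (x), μ.real (Iic x) = cdf μ x :=
    fun μ _ x => (cdf_eq_real μ x).symm
  have hIoi : ∀ (μ : Measure ℝ) [IsProbabilityMeasure μ] (x), μ.real (Ioi x) = 1 - cdf μ x :=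
    fun μ _ x => by rw [cdf_eq_real, ← compl_Iic, probReal_compl_eq_one_sub measurableSet_Iic]
  have hIoc : ∀ (μ : Measure ℝ) [IsProbabilityMeasure μ] (x y), x ≤ y →
      μ.real (Ioc x y) = cdf μ y - cdf μ x := fun μ _ x y hxy => by
    rw [cdf_eq_real, cdf_eq_real, ← Iic_sdiff_Iic,
      measureReal_sdiff (Iic_subset_Iic.2 hxy) measurableSet_Iic]
  refine ⟨hT, hc, by simpa using lo univ, by simpa using up univ, ?_, ?_, ?_, ?_, ?_, ?_⟩
  · intro x y hxy
    have := lo (Ioc (T x) (T y))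
    rwa [hIoc _ _ _ (hT hxy), hIoc _ _ _ (hT hxy), hcdf, hcdf] at this
  · intro x y hxy
    have := up (Ioc (T x) (T y))
    rwa [hIoc _ _ _ (hT hxy), hIoc _ _ _ (hT hxy), hcdf, hcdf] at this
  · intro x
    have := lo (Iic (T x))
    rwa [hIic, hIic, hcdf] at this
  · intro x
    have := up (Iic (T x))
    rwa [hIic, hIic, hcdf] at this
  · intro x
    have := lo (Ioi (T x))
    rwa [hIoi, hIoi, hcdf] at this
  · intro x
    have := up (Ioi (T x))
    rwa [hIoi, hIoi, hcdf] at this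

theorem MemPcC.memP2 {V : ℝ → ℝ} (hV : IsLogConcavePotential V) {c C : ℝ} (hC : 0 ≤ C) {f : ℝ → ℝ}
    (hf : MemPcC (fun x => Real.exp (-V x)) c C f) : MemP2 (densityMeasure f) := by
  have hP := hV.isProbabilityMeasure
  refine ⟨hf.isProbabilityMeasure, ?_⟩
  have h : densityMeasure f ≤ ENNReal.ofReal C • gibbs V :=
    Measure.le_iff.2 fun A _ => hf.le_smul hC A
  refine (lintegral_mono' h le_rfl).trans_lt ?_
  rw [lintegral_smul_measure]
  have := ((memP2_map_iff (P := gibbs V) (X := fun x => x) measurable_id).2 hV.memLp_id).2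
  rw [Measure.map_id'] at this
  exact ENNReal.mul_lt_top ENNReal.ofReal_lt_top this

namespace IsComparableTransport

variable {V : ℝ → ℝ} {c C : ℝ} {T : ℝ → ℝ}

theorem one_le_div (hT : IsComparableTransport V c C T) : 1 ≤ C / c :=
  (_root_.one_le_div hT.pos).2 (hT.le_one.trans hT.one_le)

/-- The tails at x and T x agree up to the factors 1/c on one side and C on the other, and
`exp_mul_sub_le` converts their product into a distance. The two sides exchange roles with the order
of x and T x. -/
theorem exp_displacement_le (hT : IsComparableTransport V c C T) (hV : IsLogConcavePotential V)
    (x₀ x : ℝ) : Real.exp (Real.exp (-V x₀) * |T x - x|) ≤ C / c := by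
  have hc := hT.pos
  have h1 : 1 ≤ c⁻¹ := (one_le_inv₀ hc).2 hT.le_one
  have hmul : ∀ {a b : ℝ}, c * a ≤ b → a ≤ c⁻¹ * b := fun h => by
    rwa [inv_mul_eq_div, le_div_iff₀ hc, mul_comm]
  rcases le_total x (T x) with h | h
  · rw [abs_of_nonneg (sub_nonneg.2 h)]
    refine (hV.exp_mul_sub_le (x₀ := x₀) h h1 hT.one_le (hmul (hT.left_lower x))
      (hT.right_upper x)).trans_eq ?_
    rw [inv_mul_eq_div]
  · rw [abs_sub_comm, abs_of_nonneg (sub_nonneg.2 h)]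
    exact hV.exp_mul_sub_le (x₀ := x₀) h hT.one_le h1 (hT.left_upper x) (hmul (hT.right_lower x))

theorem exp_lipschitz_displacement_le (hT : IsComparableTransport V c C T)
    (hV : IsLogConcavePotential V) {L : ℝ} (hL : 0 ≤ L) (x₀ x : ℝ) :
    Real.exp (L * |T x - x|) ≤ (C / c) ^ (L * Real.exp (V x₀)) := by
  refine le_trans (le_of_eq ?_) (Real.rpow_le_rpow (Real.exp_pos _).le
    (hT.exp_displacement_le hV x₀ x) (mul_nonneg hL (Real.exp_pos _).le))
  rw [← Real.exp_mul]
  congr 1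
  have : Real.exp (-V x₀) * Real.exp (V x₀) = 1 := by rw [← Real.exp_add]; simp
  calc _ = L * |T x - x| * 1 := (mul_one _).symm
    _ = _ := by rw [← this]; ring

theorem strictMono (hT : IsComparableTransport V c C T) (hV : IsLogConcavePotential V) :
    StrictMono T := by
  intro x y hxy
  have h1 := hV.strictMono_cdf hxy
  have h2 := hT.upper hxy.le
  have h3 : 0 < cdf (gibbs V) (T y) - cdf (gibbs V) (T x) :=
    pos_of_mul_pos_right (by linarith) (zero_le_one.trans hT.one_le)
  exact hV.strictMono_cdf.lt_iff_lt.1 (sub_pos.1 h3)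

/-- The source density is at most m(x₀) at the mode x₀, and on the compact interval [T a, T b] the
target density is bounded away from zero. The constant is only local, which suffices for the change
of variables. -/
theorem exists_lipschitzOnWith (hT : IsComparableTransport V c C T) (hV : IsLogConcavePotential V)
    (a b : ℝ) : ∃ K : ℝ≥0, LipschitzOnWith K T (Icc a b) := by
  obtain ⟨x₀, hx₀⟩ := hV.exists_forall_le
  obtain ⟨v, hv⟩ := (isCompact_Icc (a := T a) (b := T b)).bddAbove_image
    hV.diff.continuous.continuousOn
  have hc := hT.pos
  have hle : ∀ x ∈ Icc a b, ∀ y ∈ Icc a b, x ≤ y →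
      T y - T x ≤ Real.exp (-V x₀) / (c * Real.exp (-v)) * (y - x) := by
    intro x hx y hy hxy
    have h1 : Real.exp (-v) * (T y - T x) ≤ cdf (gibbs V) (T y) - cdf (gibbs V) (T x) := by
      refine (convex_Icc (T a) (T b)).mul_sub_le_image_sub_of_le_deriv
        hV.continuous_cdf.continuousOn
        (fun z _ => (hV.hasDerivAt_cdf z).differentiableAt.differentiableWithinAt)
        (fun z hz => ?_) (T x) ⟨hT.mono hx.1, hT.mono hx.2⟩ (T y) ⟨hT.mono hy.1, hT.mono hy.2⟩
        (hT.mono hxy)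
      rw [(hV.hasDerivAt_cdf z).deriv]
      exact Real.exp_le_exp.2 (neg_le_neg (hv (mem_image_of_mem V (interior_subset hz))))
    have h2 : cdf (gibbs V) y - cdf (gibbs V) x ≤ Real.exp (-V x₀) * (y - x) := by
      refine image_sub_le_mul_sub_of_deriv_le
        (fun z => (hV.hasDerivAt_cdf z).differentiableAt) (fun z => ?_) hxy
      rw [(hV.hasDerivAt_cdf z).deriv]
      exact Real.exp_le_exp.2 (neg_le_neg (hx₀ z))
    have h3 := hT.lower hxy
    have h4 := mul_le_mul_of_nonneg_left h1 hc.le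
    rw [div_mul_eq_mul_div, le_div_iff₀ (by positivity)]
    linarith
  refine ⟨Real.toNNReal (Real.exp (-V x₀) / (c * Real.exp (-v))),
    LipschitzOnWith.of_dist_le_mul fun x hx y hy => ?_⟩
  rw [Real.coe_toNNReal _ (by positivity), Real.dist_eq, Real.dist_eq]
  rcases le_total x y with h | h
  · rw [abs_sub_comm, abs_sub_comm x, abs_of_nonneg (sub_nonneg.2 (hT.mono h)),
      abs_of_nonneg (sub_nonneg.2 h)]
    exact hle x hx y hy h
  · rw [abs_of_nonneg (sub_nonneg.2 (hT.mono h)), abs_of_nonneg (sub_nonneg.2 h)]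
    exact hle y hy x hx h

/-- One side of the Monge–Ampère bound, read off from the monotonicity of F - c F∘T, with F the
distribution function of m. -/
theorem deriv_le (hT : IsComparableTransport V c C T) (hV : IsLogConcavePotential V) {x : ℝ}
    (hx : DifferentiableAt ℝ T x) :
    c * (Real.exp (-V (T x)) * deriv T x) ≤ Real.exp (-V x) := by
  have hd := (hV.hasDerivAt_cdf x).sub
    (((hV.hasDerivAt_cdf (T x)).comp x hx.hasDerivAt).const_mul c)
  have hmono : Monotone fun x => cdf (gibbs V) x - c * cdf (gibbs V) (T x) := fun y z hyz => by
    have := hT.lower hyz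
    simp only; linarith
  have := hd.nonneg_of_monotone hmono
  linarith

theorem le_deriv (hT : IsComparableTransport V c C T) (hV : IsLogConcavePotential V) {x : ℝ}
    (hx : DifferentiableAt ℝ T x) :
    Real.exp (-V x) ≤ C * (Real.exp (-V (T x)) * deriv T x) := by
  have hd := (((hV.hasDerivAt_cdf (T x)).comp x hx.hasDerivAt).const_mul C).sub
    (hV.hasDerivAt_cdf x)
  have hmono : Monotone fun x => C * cdf (gibbs V) (T x) - cdf (gibbs V) x := fun y z hyz => by
    have := hT.upper hyz
    simp only; linarith
  have := hd.nonneg_of_monotone hmono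
  linarith

theorem deriv_pos (hT : IsComparableTransport V c C T) (hV : IsLogConcavePotential V) {x : ℝ}
    (hx : DifferentiableAt ℝ T x) : 0 < deriv T x := by
  have h := (Real.exp_pos _).trans_le (hT.le_deriv hV hx)
  exact pos_of_mul_pos_right (pos_of_mul_pos_right h (zero_le_one.trans hT.one_le))
    (Real.exp_pos _).le

/-- The density of the displacement interpolation is bounded below along its trajectories. -/
theorem exp_mul_deriv_le (hT : IsComparableTransport V c C T) (hV : IsLogConcavePotential V)
    {L : ℝ≥0} (hL : LipschitzWith L V) (x₀ : ℝ) {x t : ℝ} (ht : t ∈ Icc (0 : ℝ) 1)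
    (hx : DifferentiableAt ℝ T x) :
    Real.exp (-V (x + t * (T x - x))) * (1 + t * (deriv T x - 1)) ≤
      (C / c) ^ (1 + L * Real.exp (V x₀)) * Real.exp (-V x) := by
  set E := (C / c) ^ (L * Real.exp (V x₀)) with hE
  have hc := hT.pos
  have hEpos : 0 ≤ E := Real.rpow_nonneg (zero_le_one.trans hT.one_le_div) _
  have hcmp : ∀ y, |x + t * (T x - x) - y| ≤ |T x - x| →
      Real.exp (-V (x + t * (T x - x))) ≤ Real.exp (-V y) * E := by
    intro y hy
    refine le_trans ?_ (mul_le_mul_of_nonneg_left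
      (hT.exp_lipschitz_displacement_le hV L.coe_nonneg x₀ x) (Real.exp_pos _).le)
    rw [← Real.exp_add]
    refine Real.exp_le_exp.2 ?_
    have h := hL.dist_le_mul (x + t * (T x - x)) y
    rw [Real.dist_eq, Real.dist_eq] at h
    have h' := (abs_le.1 h).1
    have := mul_le_mul_of_nonneg_left hy L.coe_nonneg
    linarith
  -- The intermediate point is compared with both ends: with x for the share 1 - t, and with T x for
  -- the share t, where m(T x) T' is controlled by m(x).
  have h1 := hcmp x (by
    rw [add_sub_cancel_left, abs_mul, abs_of_nonneg ht.1]
    exact mul_le_of_le_one_left (abs_nonneg _) ht.2)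
  have h2 := hcmp (T x) (by
    have : x + t * (T x - x) - T x = -((1 - t) * (T x - x)) := by ring
    rw [this, abs_neg, abs_mul, abs_of_nonneg (sub_nonneg.2 ht.2)]
    exact mul_le_of_le_one_left (abs_nonneg _) (by linarith [ht.1]))
  have hT' := (hT.deriv_pos hV hx).le
  have h3 : Real.exp (-V (T x)) * deriv T x ≤ c⁻¹ * Real.exp (-V x) := by
    rw [inv_mul_eq_div, le_div_iff₀ hc, mul_comm]
    exact hT.deriv_le hV hx
  have hm := Real.exp_pos (-V x)
  have hc1 : 1 ≤ c⁻¹ := (one_le_inv₀ hc).2 hT.le_one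
  calc _ = (1 - t) * Real.exp (-V (x + t * (T x - x))) +
        t * (Real.exp (-V (x + t * (T x - x))) * deriv T x) := by ring
    _ ≤ (1 - t) * (Real.exp (-V x) * E) + t * (Real.exp (-V (T x)) * E * deriv T x) := by
        have := sub_nonneg.2 ht.2
        have := ht.1
        gcongr
    _ = (1 - t) * (1 * Real.exp (-V x) * E) + t * (E * (Real.exp (-V (T x)) * deriv T x)) := by ring
    _ ≤ (1 - t) * (c⁻¹ * Real.exp (-V x) * E) + t * (E * (c⁻¹ * Real.exp (-V x))) := by
        have := sub_nonneg.2 ht.2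
        have := ht.1
        gcongr
    _ = c⁻¹ * (E * Real.exp (-V x)) := by ring
    -- The sharper factor 1/c is given up to merge with the base of the power `E`.
    _ ≤ (C / c) * (E * Real.exp (-V x)) := by
        gcongr
        rw [← one_div]
        gcongr
        exact hT.one_le
    _ = _ := by
        rw [Real.rpow_add (zero_lt_one.trans_le hT.one_le_div), Real.rpow_one]; ring

end IsComparableTransport

end

/-! ### Change of variables under monotone rearrangements -/

theorem LipschitzOnWith.volume_image_eq_zero {f : ℝ → ℝ} {K : ℝ≥0} {s : Set ℝ}
    (hf : LipschitzOnWith K f s) (hs : volume s = 0) : volume (f '' s) = 0 := by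
  have h := hf.hausdorffMeasure_image_le zero_le_one
  rw [hausdorffMeasure_real, hs, mul_zero] at h
  exact nonpos_iff_eq_zero.1 h

theorem volume_image_eq_zero_of_lipschitzOnWith_Icc {f : ℝ → ℝ}
    (hf : ∀ a b : ℝ, ∃ K : ℝ≥0, LipschitzOnWith K f (Icc a b)) {s : Set ℝ} (hs : volume s = 0) :
    volume (f '' s) = 0 := by
  have hcover : f '' s ⊆ ⋃ n : ℕ, f '' (s ∩ Icc (-n : ℝ) n) := by
    rintro _ ⟨x, hx, rfl⟩
    obtain ⟨n, hn⟩ := exists_nat_ge |x|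
    exact mem_iUnion.2 ⟨n, mem_image_of_mem f ⟨hx, abs_le.1 hn⟩⟩
  refine measure_mono_null hcover (measure_iUnion_null fun n => ?_)
  obtain ⟨K, hK⟩ := hf (-n) n
  exact (hK.mono inter_subset_right).volume_image_eq_zero (measure_mono_null inter_subset_left hs)

theorem continuous_of_lipschitzOnWith_Icc {f : ℝ → ℝ}
    (hf : ∀ a b : ℝ, ∃ K : ℝ≥0, LipschitzOnWith K f (Icc a b)) : Continuous f := by
  refine continuous_iff_continuousAt.2 fun x => ?_
  obtain ⟨K, hK⟩ := hf (x - 1) (x + 1)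
  exact hK.continuousOn.continuousAt (Icc_mem_nhds (by linarith) (by linarith))

/-- A strictly increasing bijection of the line, Lipschitz on bounded intervals and with positive
derivative almost everywhere. -/
structure IsMonotoneRearrangement (φ : ℝ → ℝ) : Prop where
  strictMono : StrictMono φ
  lipschitz : ∀ a b : ℝ, ∃ K : ℝ≥0, LipschitzOnWith K φ (Icc a b)
  surjective : Function.Surjective φ
  deriv_pos : ∀ᵐ x, DifferentiableAt ℝ φ x ∧ 0 < deriv φ x

namespace IsMonotoneRearrangement

variable {φ : ℝ → ℝ}

theorem continuous (hφ : IsMonotoneRearrangement φ) : Continuous φ :=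
  continuous_of_lipschitzOnWith_Icc hφ.lipschitz

/-- Points where φ is not differentiable with positive derivative form a null set, and local
Lipschitz continuity keeps its image null. The classical formula applies to the rest. -/
theorem setLIntegral_image (hφ : IsMonotoneRearrangement φ) {B : Set ℝ} (hB : MeasurableSet B)
    (g : ℝ → ℝ≥0∞) :
    ∫⁻ y in φ '' B, g y = ∫⁻ x in B, ENNReal.ofReal (deriv φ x) * g (φ x) := by
  set s : Set ℝ := {x | DifferentiableAt ℝ φ x ∧ 0 < deriv φ x} with hs
  have hsm : MeasurableSet s :=
    (measurableSet_of_differentiableAt ℝ φ).inter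
      (measurableSet_lt measurable_const (measurable_deriv φ))
  have hsc : volume sᶜ = 0 := hφ.deriv_pos
  have h1 : (B ∩ s : Set ℝ) =ᵐ[volume] B := by
    refine inter_ae_eq_left_of_ae_eq_univ ?_
    exact Filter.eventuallyEq_univ.2 hφ.deriv_pos
  have h2 : (φ '' (B ∩ s) : Set ℝ) =ᵐ[volume] φ '' B := by
    refine (LE.le.eventuallyLE (image_mono inter_subset_left)).antisymm ?_
    rw [ae_le_set]
    refine measure_mono_null ?_ (volume_image_eq_zero_of_lipschitzOnWith_Icc hφ.lipschitz hsc)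
    rintro _ ⟨⟨x, hx, rfl⟩, hn⟩
    exact mem_image_of_mem φ fun hxs => hn (mem_image_of_mem φ ⟨hx, hxs⟩)
  rw [← setLIntegral_congr h2, ← setLIntegral_congr h1,
    lintegral_image_eq_lintegral_abs_deriv_mul (hB.inter hsm)
      (fun x hx => hx.2.1.hasDerivAt.hasDerivWithinAt) hφ.strictMono.injective.injOn]
  refine setLIntegral_congr_fun (hB.inter hsm) fun x hx => ?_
  simp only [abs_of_pos hx.2.2]

theorem lintegral_comp (hφ : IsMonotoneRearrangement φ) (g : ℝ → ℝ≥0∞) :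
    ∫⁻ y, g y = ∫⁻ x, ENNReal.ofReal (deriv φ x) * g (φ x) := by
  have := hφ.setLIntegral_image MeasurableSet.univ g
  rwa [image_univ, hφ.surjective.range_eq, setLIntegral_univ, setLIntegral_univ] at this

/-- For a null set A the change of variables makes φ' vanish almost everywhere on the preimage of A;
as φ' > 0 almost everywhere, that preimage is null. -/
theorem absolutelyContinuous_map (hφ : IsMonotoneRearrangement φ) (m : ℝ → ℝ) :
    (densityMeasure m).map φ ≪ volume := by
  refine Measure.AbsolutelyContinuous.mk fun A hA h0 => ?_
  rw [Measure.map_apply hφ.continuous.measurable hA]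
  refine withDensity_absolutelyContinuous _ _ ?_
  have hm : Measurable fun x => ENNReal.ofReal (deriv φ x) * A.indicator 1 (φ x) :=
    (measurable_deriv φ).ennreal_ofReal.mul
      ((measurable_one.indicator hA).comp hφ.continuous.measurable)
  rw [← lintegral_indicator_one hA, hφ.lintegral_comp, lintegral_eq_zero_iff hm] at h0
  refine measure_eq_zero_iff_ae_notMem.2 ?_
  filter_upwards [h0, hφ.deriv_pos] with x hx hd hxA
  have h1 : A.indicator (1 : ℝ → ℝ≥0∞) (φ x) = 1 :=
      indicator_of_mem (s := A) hxA _
  simp only [Pi.zero_apply, h1, mul_one, ENNReal.ofReal_eq_zero] at hx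
  exact absurd hd.2 (not_lt.2 hx)

/-- The Monge–Ampère equation for the density of an image measure. -/
theorem ofReal_eq_deriv_mul_rnDeriv (hφ : IsMonotoneRearrangement φ) {m : ℝ → ℝ}
    (hm : Measurable m) [IsFiniteMeasure (densityMeasure m)] :
    ∀ᵐ x, ENNReal.ofReal (m x) =
      ENNReal.ofReal (deriv φ x) * ((densityMeasure m).map φ).rnDeriv volume (φ x) := by
  set h := ((densityMeasure m).map φ).rnDeriv volume with hh
  have hmeas : Measurable fun x => ENNReal.ofReal (deriv φ x) * h (φ x) :=
    (measurable_deriv φ).ennreal_ofReal.mul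
      ((Measure.measurable_rnDeriv _ _).comp hφ.continuous.measurable)
  have hemb := hφ.continuous.measurableEmbedding hφ.strictMono.injective
  refine (withDensity_eq_iff_of_sigmaFinite hm.ennreal_ofReal.aemeasurable hmeas.aemeasurable).1 ?_
  refine Measure.ext fun B hB => ?_
  rw [withDensity_apply (fun x => ENNReal.ofReal (deriv φ x) * h (φ x)) hB,
    ← hφ.setLIntegral_image hB, Measure.setLIntegral_rnDeriv (hφ.absolutelyContinuous_map m),
    hemb.map_apply, hφ.strictMono.injective.preimage_image]
  rfl

theorem ultrafastEnergy_map (hφ : IsMonotoneRearrangement φ) {m : ℝ → ℝ} (hm : Measurable m)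
    (hm0 : ∀ x, 0 < m x) [IsFiniteMeasure (densityMeasure m)] {r : ℝ} (ρ : ℝ → ℝ) :
    ultrafastEnergy r ρ ((densityMeasure m).map φ) =
      ∫⁻ x, ENNReal.ofReal (deriv φ x * (ρ (φ x) / (m x / deriv φ x) ^ r)) := by
  rw [ultrafastEnergy, if_pos (hφ.absolutelyContinuous_map m), hφ.lintegral_comp]
  refine lintegral_congr_ae ?_
  filter_upwards [hφ.ofReal_eq_deriv_mul_rnDeriv hm, hφ.deriv_pos] with x hx hd
  have h1 : ((densityMeasure m).map φ).rnDeriv volume (φ x) =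
      ENNReal.ofReal (m x / deriv φ x) := by
    rw [ENNReal.ofReal_div_of_pos hd.2, hx, mul_comm, ENNReal.mul_div_cancel_right]
    · simpa using hd.2
    · exact ENNReal.ofReal_ne_top
  have hq : 0 < m x / deriv φ x := div_pos (hm0 x) hd.2
  rw [h1, ENNReal.ofReal_rpow_of_pos hq, ← ENNReal.ofReal_div_of_pos (Real.rpow_pos_of_pos hq r),
    ← ENNReal.ofReal_mul hd.2.le]

end IsMonotoneRearrangement

/-! ### The energy along the displacement interpolation -/

theorem IsComparableTransport.abs_displacement_le {V : ℝ → ℝ} {c C : ℝ} {T : ℝ → ℝ}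
    (hT : IsComparableTransport V c C T) (hV : IsLogConcavePotential V) :
    ∃ D : ℝ, ∀ x, |T x - x| ≤ D := by
  refine ⟨Real.log (C / c) / Real.exp (-V 0), fun x => ?_⟩
  rw [le_div_iff₀ (Real.exp_pos _), mul_comm,
    Real.le_log_iff_exp_le (zero_lt_one.trans_le hT.one_le_div)]
  exact hT.exp_displacement_le hV 0 x

theorem IsComparableTransport.isMonotoneRearrangement {V : ℝ → ℝ} {c C : ℝ} {T : ℝ → ℝ}
    (hT : IsComparableTransport V c C T) (hV : IsLogConcavePotential V) {t : ℝ}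
    (ht : t ∈ Icc (0 : ℝ) 1) : IsMonotoneRearrangement fun x => (1 - t) * x + t * T x := by
  have hlip : ∀ a b : ℝ, ∃ K : ℝ≥0,
      LipschitzOnWith K (fun x => (1 - t) * x + t * T x) (Icc a b) := by
    intro a b
    obtain ⟨K, hK⟩ := hT.exists_lipschitzOnWith hV a b
    refine ⟨‖(1 - t : ℝ)‖₊ * 1 + ‖t‖₊ * K, ?_⟩
    exact ((lipschitzWith_smul (1 - t : ℝ)).comp_lipschitzOnWith LipschitzWith.id.lipschitzOnWith).add
      ((lipschitzWith_smul t).comp_lipschitzOnWith hK)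
  obtain ⟨D, hD⟩ := hT.abs_displacement_le hV
  have hdist : ∀ x, |(1 - t) * x + t * T x - x| ≤ D := fun x => by
    have : (1 - t) * x + t * T x - x = t * (T x - x) := by ring
    rw [this, abs_mul, abs_of_nonneg ht.1]
    exact (mul_le_of_le_one_left (abs_nonneg _) ht.2).trans (hD x)
  refine ⟨?_, hlip, ?_, ?_⟩
  · rcases ht.1.eq_or_lt with h | h
    · intro x y hxy
      simpa [← h] using hxy
    · exact (monotone_id.const_mul (sub_nonneg.2 ht.2)).add_strictMono
        ((hT.strictMono hV).const_mul h)
  · refine (continuous_of_lipschitzOnWith_Icc hlip).surjective ?_ ?_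
    · refine Filter.tendsto_atTop_mono (f := fun x => x + -D) (fun x => ?_)
        (Filter.tendsto_atTop_add_const_right _ _ Filter.tendsto_id)
      linarith [(abs_le.1 (hdist x)).1]
    · refine Filter.tendsto_atBot_mono (f := fun x => x + D) (fun x => ?_)
        (Filter.tendsto_atBot_add_const_right _ _ Filter.tendsto_id)
      linarith [(abs_le.1 (hdist x)).2]
  · filter_upwards [hT.mono.ae_differentiableAt] with x hx
    have hd : HasDerivAt (fun x => (1 - t) * x + t * T x) ((1 - t) + t * deriv T x) x := by
      exact (((hasDerivAt_id x).const_mul (1 - t)).add (hx.hasDerivAt.const_mul t)).congr_deriv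
        (by rw [mul_one])
    refine ⟨hd.differentiableAt, ?_⟩
    rw [hd.deriv]
    have hp := hT.deriv_pos hV hx
    rcases ht.1.eq_or_lt with h | h
    · simp [← h]
    · have := mul_pos h hp
      linarith [ht.2]

/-- The integrand of the ultrafast diffusion energy at time `t` of the displacement interpolation
along `T`, in the variables of the reference measure. -/
noncomputable def ultrafastIntegrand (r : ℝ) (V T : ℝ → ℝ) (t x : ℝ) : ℝ :=
  (Real.exp (-V (x + t * (T x - x))) * (1 + t * (deriv T x - 1))) ^ (r + 1) * Real.exp (r * V x)

/-- The choice ρ = m^(r+1) collects the target density and the Jacobian in a single power, leaving a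
weight m(x)^(-r) independent of time. -/
theorem ultrafast_scaling {r : ℝ} (v w d : ℝ) (hd : 0 < d) :
    d * (Real.exp (-((r + 1) * w)) / (Real.exp (-v) / d) ^ r) =
      (Real.exp (-w) * d) ^ (r + 1) * Real.exp (r * v) := by
  have h1 : (Real.exp (-w) * d) ^ (r + 1) = Real.exp (-((r + 1) * w)) * (d ^ r * d) := by
    rw [Real.mul_rpow (Real.exp_pos _).le hd.le, ← Real.exp_mul, Real.rpow_add hd, Real.rpow_one]
    congr 2; ring
  have h2 : (Real.exp (-v) / d) ^ r = Real.exp (-(r * v)) / d ^ r := by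
    rw [Real.div_rpow (Real.exp_pos _).le hd.le, ← Real.exp_mul]
    congr 2; ring
  have h3 : 0 < d ^ r := Real.rpow_pos_of_pos hd r
  rw [h1, h2, Real.exp_neg (r * v)]
  field_simp

namespace IsComparableTransport

variable {V : ℝ → ℝ} {c C : ℝ} {T : ℝ → ℝ}

theorem ultrafastEnergy_eq (hT : IsComparableTransport V c C T) (hV : IsLogConcavePotential V)
    (r : ℝ) {t : ℝ} (ht : t ∈ Icc (0 : ℝ) 1) :
    ultrafastEnergy r (fun x => Real.exp (-((r + 1) * V x)))
      ((gibbs V).map fun x => (1 - t) * x + t * T x) =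
      ∫⁻ x, ENNReal.ofReal (ultrafastIntegrand r V T t x) := by
  have hP := hV.isProbabilityMeasure
  have hφ := hT.isMonotoneRearrangement hV ht
  rw [hφ.ultrafastEnergy_map hV.continuous_exp_neg.measurable fun x => Real.exp_pos _]
  refine lintegral_congr_ae ?_
  filter_upwards [hφ.deriv_pos, hT.mono.ae_differentiableAt] with x hx hTx
  have hd : deriv (fun x => (1 - t) * x + t * T x) x = 1 + t * (deriv T x - 1) := by
    refine (((hasDerivAt_id x).const_mul (1 - t)).add (hTx.hasDerivAt.const_mul t)).deriv.trans ?_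
    ring
  rw [ultrafast_scaling _ _ _ hx.2, ultrafastIntegrand, hd,
    show (1 - t) * x + t * T x = x + t * (T x - x) by ring]

theorem measurable_ultrafastIntegrand (hT : IsComparableTransport V c C T)
    (hV : IsLogConcavePotential V) (r t : ℝ) : Measurable (ultrafastIntegrand r V T t) := by
  have h1 := hT.mono.measurable
  have h2 := hV.diff.continuous.measurable
  have h3 := measurable_deriv T
  unfold ultrafastIntegrand
  fun_prop

/-- The factor that controls the density of the interpolation relative to `e ^ {-V}`. -/
theorem rpow_le_densityBound (hT : IsComparableTransport V c C T) (hV : IsLogConcavePotential V)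
    {L : ℝ≥0} (hL : LipschitzWith L V) (x₀ : ℝ) :
    (C / c) ^ (1 + L * Real.exp (V x₀)) ≤
      L * Real.exp (V x₀) * (C / c) ^ (1 + L * Real.exp (V x₀)) := by
  refine le_mul_of_one_le_left (Real.rpow_nonneg (zero_le_one.trans hT.one_le_div) _) ?_
  have h := mul_le_mul_of_nonneg_right (hV.exp_neg_le_of_lipschitz hL x₀) (Real.exp_pos (V x₀)).le
  rwa [← Real.exp_add, neg_add_cancel, Real.exp_zero] at h

theorem exp_mul_deriv_le_densityBound (hT : IsComparableTransport V c C T)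
    (hV : IsLogConcavePotential V) {L : ℝ≥0} (hL : LipschitzWith L V) (x₀ : ℝ) {x t : ℝ}
    (ht : t ∈ Icc (0 : ℝ) 1) (hx : DifferentiableAt ℝ T x) :
    Real.exp (-V (x + t * (T x - x))) * (1 + t * (deriv T x - 1)) ≤
      L * Real.exp (V x₀) * (C / c) ^ (1 + L * Real.exp (V x₀)) * Real.exp (-V x) :=
  (hT.exp_mul_deriv_le hV hL x₀ ht hx).trans
    (mul_le_mul_of_nonneg_right (hT.rpow_le_densityBound hV hL x₀) (Real.exp_pos _).le)

theorem one_add_mul_deriv_pos (hT : IsComparableTransport V c C T)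
    (hV : IsLogConcavePotential V) {x t : ℝ} (ht : t ∈ Icc (0 : ℝ) 1)
    (hx : DifferentiableAt ℝ T x) : 0 < 1 + t * (deriv T x - 1) := by
  have hp := hT.deriv_pos hV hx
  rcases ht.1.eq_or_lt with h | h
  · simp [← h]
  · have := mul_pos h hp
    linarith [ht.2]

/-- The weight m^(-r) cancels all but one power of m, which is the reference measure in which W₂² is
computed. -/
theorem densityBound_rpow {r K : ℝ} (hK : 0 ≤ K) (v : ℝ) :
    (K * Real.exp (-v)) ^ (r + 1) * Real.exp (r * v) = K ^ (r + 1) * Real.exp (-v) := by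
  rw [Real.mul_rpow hK (Real.exp_pos _).le, ← Real.exp_mul, mul_assoc, ← Real.exp_add]
  congr 2; ring

theorem ultrafastIntegrand_semiconvex (hT : IsComparableTransport V c C T)
    (hV : IsLogConcavePotential V) {L : ℝ≥0} (hL : LipschitzWith L V)
    (hL' : LipschitzWith L (deriv V)) {r : ℝ} (hr : 0 < r) (x₀ : ℝ) {x : ℝ}
    (hx : DifferentiableAt ℝ T x) {s t θ : ℝ} (hs : s ∈ Icc (0 : ℝ) 1) (ht : t ∈ Icc (0 : ℝ) 1)
    (hθ : θ ∈ Icc (0 : ℝ) 1) :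
    ultrafastIntegrand r V T ((1 - θ) * s + θ * t) x ≤
      (1 - θ) * ultrafastIntegrand r V T s x + θ * ultrafastIntegrand r V T t x +
        semiconvexityConst r L (V x₀) c C / 2 * θ * (1 - θ) * (s - t) ^ 2 *
          ((T x - x) ^ 2 * Real.exp (-V x)) := by
  set K := L * Real.exp (V x₀) * (C / c) ^ (1 + L * Real.exp (V x₀)) with hK
  have hK0 : 0 ≤ K := mul_nonneg (mul_nonneg L.coe_nonneg (Real.exp_pos _).le)
    (Real.rpow_nonneg (zero_le_one.trans hT.one_le_div) _)
  have hconv := convexOn_ultrafast_integrand hL hV.diff hL' hr (a := x) (S := T x - x)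
    (σ := deriv T x - 1) (B := K * Real.exp (-V x))
    (fun t ht => hT.one_add_mul_deriv_pos hV ht hx)
    (fun t ht => hT.exp_mul_deriv_le_densityBound hV hL x₀ ht hx)
  have h := hconv.2 hs ht (sub_nonneg.2 hθ.2) hθ.1 (by ring)
  simp only [smul_eq_mul] at h
  have h' := mul_le_mul_of_nonneg_right h (Real.exp_pos (r * V x)).le
  have hb := densityBound_rpow (r := r) hK0 (V x)
  unfold ultrafastIntegrand semiconvexityConst
  rw [← hK]
  have e : (r + 1) * L * ((r + 1) * L / r + 1) * K ^ (r + 1) / 2 * θ * (1 - θ) * (s - t) ^ 2 *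
      ((T x - x) ^ 2 * Real.exp (-V x)) =
      (r + 1) * L * ((r + 1) * L / r + 1) / 2 * θ * (1 - θ) * (s - t) ^ 2 * (T x - x) ^ 2 *
      ((K * Real.exp (-V x)) ^ (r + 1) * Real.exp (r * V x)) := by
    rw [hb]; ring
  rw [e]
  -- The added quadratic term contributes through (1-θ)s² + θt² - ((1-θ)s + θt)² = θ(1-θ)(s-t)².
  refine le_of_sub_nonneg ((sub_nonneg.2 h').trans_eq ?_)
  ring

theorem lintegral_ultrafastIntegrand_ne_top (hT : IsComparableTransport V c C T)
    (hV : IsLogConcavePotential V) {L : ℝ≥0} (hL : LipschitzWith L V) {r : ℝ} (hr : 0 < r)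
    {t : ℝ} (ht : t ∈ Icc (0 : ℝ) 1) :
    ∫⁻ x, ENNReal.ofReal (ultrafastIntegrand r V T t x) ≠ ∞ := by
  set K := (L : ℝ) * Real.exp (V 0) * (C / c) ^ (1 + L * Real.exp (V 0)) with hK
  have hK0 : 0 ≤ K := mul_nonneg (mul_nonneg L.coe_nonneg (Real.exp_pos _).le)
    (Real.rpow_nonneg (zero_le_one.trans hT.one_le_div) _)
  refine (lt_of_le_of_lt (lintegral_mono_ae ?_)
    (hV.integrable.const_mul (K ^ (r + 1))).lintegral_lt_top).ne
  filter_upwards [hT.mono.ae_differentiableAt] with x hx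
  refine ENNReal.ofReal_le_ofReal ?_
  rw [← densityBound_rpow hK0, ultrafastIntegrand]
  refine mul_le_mul_of_nonneg_right (Real.rpow_le_rpow ?_
    (hT.exp_mul_deriv_le_densityBound hV hL 0 ht hx) (by positivity)) (Real.exp_pos _).le
  exact mul_nonneg (Real.exp_pos _).le (hT.one_add_mul_deriv_pos hV ht hx).le

end IsComparableTransport

theorem W2_map_map_sq {P : Measure ℝ} [IsProbabilityMeasure P] {X Y : ℝ → ℝ}
    (hX : Monotone X) (hY : Monotone Y) :
    W2 (P.map X) (P.map Y) ^ 2 = ∫⁻ x, ENNReal.ofReal ((Y x - X x) ^ 2) ∂P := by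
  rw [W2_map_map_eq_eLpNorm hX hY,
    eLpNorm_eq_lintegral_rpow_enorm_toReal two_ne_zero ENNReal.ofNat_ne_top]
  simp only [ENNReal.toReal_ofNat]
  rw [← ENNReal.rpow_natCast, ← ENNReal.rpow_mul]
  norm_num
  refine lintegral_congr fun x => ?_
  rw [Real.enorm_eq_ofReal_abs, ← ENNReal.ofReal_pow (abs_nonneg _), sq_abs]
  congr 1; ring

theorem semiconvexityConst_nonneg {r L v c C : ℝ} (hr : 0 < r) (hL : 0 ≤ L) (hc : 0 < c)
    (hC : 0 < C) : 0 ≤ semiconvexityConst r L v c C := by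
  unfold semiconvexityConst
  positivity

/-- The ultrafast diffusion energy is semiconvex along displacement interpolations between
comparable densities. -/
theorem IsComparableTransport.isConvexAlong {V : ℝ → ℝ} {c C : ℝ} {T : ℝ → ℝ}
    (hT : IsComparableTransport V c C T)
    (hV : IsLogConcavePotential V) {L : ℝ≥0} (hL : LipschitzWith L V)
    (hL' : LipschitzWith L (deriv V)) {r : ℝ} (hr : 0 < r) (hT2 : MemLp T 2 (gibbs V)) (x₀ : ℝ) :
    IsConvexAlong (ultrafastEnergy r fun x => Real.exp (-((r + 1) * V x)))
      (-semiconvexityConst r L (V x₀) c C)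
      (fun t => (gibbs V).map fun x => (1 - t) * x + t * T x) := by
  intro s hs t ht θ hθ
  have hP := hV.isProbabilityMeasure
  have hu : (1 - θ) * s + θ * t ∈ Icc (0 : ℝ) 1 :=
    (convex_Icc (0 : ℝ) 1) hs ht (sub_nonneg.2 hθ.2) hθ.1 (by ring)
  set lam := semiconvexityConst r L (V x₀) c C with hlam
  have hlam0 : 0 ≤ lam :=
    semiconvexityConst_nonneg hr L.coe_nonneg hT.pos (zero_lt_one.trans_le hT.one_le)
  have hmono : ∀ u ∈ Icc (0 : ℝ) 1, Monotone fun x => (1 - u) * x + u * T x := fun u hu =>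
    monotone_interpolate monotone_id hT.mono hu
  set W := W2 ((gibbs V).map fun x => (1 - s) * x + s * T x)
    ((gibbs V).map fun x => (1 - t) * x + t * T x) with hW
  have hm := hV.continuous_exp_neg.measurable
  have hTm := hT.mono.measurable
  have hWsq : W ^ 2 = ∫⁻ x, ENNReal.ofReal ((s - t) ^ 2 * ((T x - x) ^ 2 * Real.exp (-V x))) := by
    rw [hW, W2_map_map_sq (hmono s hs) (hmono t ht), gibbs, densityMeasure,
      lintegral_withDensity_eq_lintegral_mul _ hm.ennreal_ofReal (by fun_prop)]
    refine lintegral_congr fun x => ?_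
    rw [Pi.mul_apply, ← ENNReal.ofReal_mul (Real.exp_pos _).le]
    congr 1; ring
  have hWtop : W ≠ ∞ := by
    rw [hW, W2_map_map_eq_eLpNorm (hmono s hs) (hmono t ht)]
    exact (((hV.memLp_id.const_mul (1 - s)).add (hT2.const_mul s)).sub
      ((hV.memLp_id.const_mul (1 - t)).add (hT2.const_mul t))).eLpNorm_ne_top
  set G : ℝ → ℝ≥0∞ := fun u => ∫⁻ x, ENNReal.ofReal (ultrafastIntegrand r V T u x) with hG
  have hGtop : ∀ u ∈ Icc (0 : ℝ) 1, G u ≠ ∞ := fun u hu =>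
    hT.lintegral_ultrafastIntegrand_ne_top hV hL hr hu
  have h1θ := sub_nonneg.2 hθ.2
  have hk : 0 ≤ lam / 2 * θ * (1 - θ) :=
    mul_nonneg (mul_nonneg (by positivity) hθ.1) h1θ
  have hmeas := fun u => (hT.measurable_ultrafastIntegrand hV r u).ennreal_ofReal
  have hst : Measurable fun x =>
      ENNReal.ofReal (1 - θ) * ENNReal.ofReal (ultrafastIntegrand r V T s x) +
        ENNReal.ofReal θ * ENNReal.ofReal (ultrafastIntegrand r V T t x) :=
    ((hmeas s).const_mul _).add ((hmeas t).const_mul _)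
  have key : G ((1 - θ) * s + θ * t) ≤ ENNReal.ofReal (1 - θ) * G s + ENNReal.ofReal θ * G t +
      ENNReal.ofReal (lam / 2 * θ * (1 - θ)) * W ^ 2 := by
    rw [hWsq, hG, ← lintegral_const_mul _ (hmeas s), ← lintegral_const_mul _ (hmeas t),
      ← lintegral_const_mul _ (by fun_prop), ← lintegral_add_left ((hmeas s).const_mul _), ← lintegral_add_left hst]
    refine lintegral_mono_ae ?_
    filter_upwards [hT.mono.ae_differentiableAt] with x hx
    rw [← ENNReal.ofReal_mul h1θ, ← ENNReal.ofReal_mul hθ.1, ← ENNReal.ofReal_mul hk]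
    refine le_trans (ENNReal.ofReal_le_ofReal ((hT.ultrafastIntegrand_semiconvex hV hL hL' hr x₀
      hx hs ht hθ).trans_eq ?_)) (ENNReal.ofReal_add_le.trans (by gcongr; exact ENNReal.ofReal_add_le))
    rw [← hlam]; ring
  -- All terms are finite, so the inequality passes to the reals, where the negative convexity
  -- constant can be subtracted.
  have keyR : (G ((1 - θ) * s + θ * t)).toReal ≤ (1 - θ) * (G s).toReal + θ * (G t).toReal -
      (-lam / 2 * θ * (1 - θ) * W.toReal ^ 2) := by
    have t1 : ENNReal.ofReal (1 - θ) * G s ≠ ∞ := ENNReal.mul_ne_top ENNReal.ofReal_ne_top (hGtop s hs)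
    have t2 : ENNReal.ofReal θ * G t ≠ ∞ := ENNReal.mul_ne_top ENNReal.ofReal_ne_top (hGtop t ht)
    have t3 : ENNReal.ofReal (lam / 2 * θ * (1 - θ)) * W ^ 2 ≠ ∞ :=
      ENNReal.mul_ne_top ENNReal.ofReal_ne_top (ENNReal.pow_ne_top hWtop)
    have := ENNReal.toReal_mono (ENNReal.add_ne_top.2 ⟨ENNReal.add_ne_top.2 ⟨t1, t2⟩, t3⟩) key
    rw [ENNReal.toReal_add (ENNReal.add_ne_top.2 ⟨t1, t2⟩) t3, ENNReal.toReal_add t1 t2,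
      ENNReal.toReal_mul, ENNReal.toReal_mul, ENNReal.toReal_mul, ENNReal.toReal_pow,
      ENNReal.toReal_ofReal h1θ, ENNReal.toReal_ofReal hθ.1, ENNReal.toReal_ofReal hk] at this
    refine this.trans_eq ?_
    ring
  simp only
  rw [hT.ultrafastEnergy_eq hV r hs, hT.ultrafastEnergy_eq hV r ht, hT.ultrafastEnergy_eq hV r hu,
    ← EReal.coe_ennreal_toReal (hGtop s hs), ← EReal.coe_ennreal_toReal (hGtop t ht),
    ← EReal.coe_ennreal_toReal (hGtop _ hu)]
  exact_mod_cast keyR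

theorem mainTheorem2 (r : ℝ) (hr : 0 < r) (V : ℝ → ℝ) (L : ℝ≥0)
    (hV_convex : ConvexOn ℝ univ V) (hV_lip : LipschitzWith L V)
    (hV_diff : Differentiable ℝ V) (hV'_lip : LipschitzWith L (deriv V))
    (hm_mass : ∫⁻ x, ENNReal.ofReal (Real.exp (-V x)) = 1)
    (c C : ℝ) (hc : 0 < c) (hcC : c < C) :
    ∃ lam : ℝ, lam = semiconvexityConst r L (⨅ x, V x) c C ∧
      ∀ f : ℝ → ℝ, MemPcC (fun x => Real.exp (-V x)) c C f →
        ∃ μ : ℝ → Measure ℝ,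
          IsW2Geodesic μ (densityMeasure fun x => Real.exp (-V x)) (densityMeasure f) ∧
          (∀ ν : ℝ → Measure ℝ,
            IsW2Geodesic ν (densityMeasure fun x => Real.exp (-V x)) (densityMeasure f) →
              ∀ t ∈ Icc (0 : ℝ) 1, ν t = μ t) ∧
          IsConvexAlong (ultrafastEnergy r fun x => Real.exp (-((r + 1) * V x))) (-lam) μ := by
  refine ⟨_, rfl, fun f hf => ?_⟩
  have hV : IsLogConcavePotential V := ⟨hV_convex, hV_diff, hm_mass⟩
  have hP := hV.isProbabilityMeasure
  -- V attains its infimum, so the constant obtained with base point x₀ is the announced one.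
  obtain ⟨x₀, hx₀⟩ := hV.exists_forall_le
  have hinf : ⨅ x, V x = V x₀ :=
    le_antisymm (ciInf_le ⟨V x₀, forall_mem_range.2 hx₀⟩ x₀) (le_ciInf hx₀)
  have hfP := hf.isProbabilityMeasure
  obtain ⟨T, hTmono, hTf⟩ := exists_monotone_map_eq hV.continuous_cdf hV.strictMono_cdf
    (densityMeasure f)
  have hT := hV.isComparableTransport hc hcC hf hTmono hTf
  have hT2 : MemLp T 2 (gibbs V) := by
    rw [← memP2_map_iff hTmono.measurable, hTf]
    exact hf.memP2 hV (hc.trans hcC).le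
  have hid : (gibbs V).map (fun x => x) = densityMeasure fun x => Real.exp (-V x) := Measure.map_id'
  have hgeo := isW2Geodesic_map monotone_id hTmono hV.memLp_id hT2
  refine ⟨fun t => (gibbs V).map fun x => (1 - t) * x + t * T x, ?_, fun ν hν t ht => ?_, ?_⟩
  · rw [← hid, ← hTf]
    exact hgeo
  · rw [← hid, ← hTf] at hν
    exact IsW2Geodesic.eq_map hV.continuous_cdf hV.strictMono_cdf monotone_id hTmono hV.memLp_id
      hT2 hν ht
  · rw [hinf]
    exact hT.isConvexAlong hV hV_lip hV'_lip hr hT2 x₀
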